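/- **Setting.** The vertices of the Young–Fibonacci graph $\mathbb{YF}$ are the finite words over $\{1,2\}$ (including the empty word $\varepsilon$). For a word $x$ let $|x|$ be the sum of its digits, $\#x$ the number of its digits and $d(x)$ the number of its twos. An upward edge leads from $x$ to every word obtained from $x$ either by replacing the leftmost $1$ by $2$, or by inserting a $1$ to the left of the leftmost $1$ (anywhere, if $x$ contains no $1$). For $|y|\ge|x|$ and $S\in\mathbb{N}_0$ let $d(x,y,S)$ be the number of paths $y=y_0,y_1,\dots,y_n=x$ in $\mathbb{YF}$ (consecutive vertices adjacent, repetitions allowed) with exactly $S$ up-steps, i.e. with exactly $S$ indices $i$ such that $|y_i|=|y_{i-1}|+1$. Let $h(x,y)$ be the number of digits of the longest common suffix of $x$ and $y$. *Lower function* $f(x,y,z)$, $x\in\mathbb{YF}$, $0\le y\le|x|$, $0\le z\le\#x$. If $x=\alpha_1\cdots\alpha_n$ and $\alpha_{m+1}+\dots+\alpha_n=y$, then $$f(x,y,0)=\prod_{k=m+1}^{n}\frac{1}{-(\alpha_{m+1}+\dots+\alpha_k)}\cdot\prod_{k=1}^{m}\frac{1}{\alpha_m+\alpha_{m-1}+\dots+\alpha_k};$$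 if there is no such $m$, then $f(x,y,0)=0$. For $z>0$: $f(x1,0,z)=f(x1,0,0)$; $f(x1,y,z)=f(x1,y,0)+f(x,y-1,z-1)$ if $y>0$; $f(x2,y,z)=f(x11,y,z+1)/(1-y)$ if $y\ne1$, and $f(x2,1,z)=0$. *Upper function.* If $x=1^{\beta_{d(x)}}\,2\,1^{\beta_{d(x)-1}}\,2\cdots2\,1^{\beta_1}\,2\,1^{\beta_0}$, then $g(x,j)=\beta_0+\dots+\beta_{j-1}+2j-1$ for $1\le j\le d(x)$. Put $$F(x,y,i)=f(x,i,h(x,y))\prod_{j=1}^{d(y)}\bigl(g(y,j)-i\bigr),\qquad m(X,S)=\min\{\lfloor X/2\rfloor,S\},\qquad (-1)!!=1 .$$ **Theorem.** Let $x,y\in\mathbb{YF}$ with $|y|\ge|x|$, and let $S\in\mathbb{N}_0$. Then there are finitely many paths from $y$ to $x$ with exactly $S$ up-steps, and $$d(x,y,S)=\sum_{i=0}^{|x|}\left(\sum_{k=0}^{m(|x|-i,S)}(-1)^k\binom{|x|-i}{2k}(2k-1)!!\binom{|y|-i+2S-2k}{|y|-i}(2S-2k-1)!!\right)F(x,y,i).$$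 Moreover, this gives an explicit (non-recursive) formula for $d(x,y,S)$ with $O(|x|^3)$ summands, uniformly in $y$ and $S$, in the following sense. For $0\le a\le |x|$ let $s(x,a)$ be $u1$ if $x=u1v$ with $|v|=a$; $u11$ if $x=u2v$ with $|v|=a$; $u1$ if $x=u2v$ with $|v|=a-1$; and $\varepsilon$ if $a=|x|$. Let $p=p(x,z)$ be the sum of the last $z$ digits of $x$, let $x^{(z)}$ be $x$ without its last $z$ digits, and let $D_b(x,y)$ be the product of $g(x,j)-y$ over all $j\in\{1,\dots,d(x)\}$ with $g(x,j)\le b$. Then for $0\le y\le|x|$ and $0\le z\le\#x$ $$f(x,y,z)=\begin{cases}f(x,0,0), & y=0,\\[2pt] \displaystyle\sum_{l=0}^{p-1}\frac{f(s(x,l),y-l,0)}{D_{l+1}(x,y)}+\frac{f(x^{(z)},y-p,0)}{D_{p}(x,y)}, & y\ge1,\ p\le y-1,\\[8pt] \displaystyle\sum_{l=0}^{y-2}\frac{f(s(x,l),y-l,0)}{D_{l+1}(x,y)}, & y\ge1,\ p\ge y.\end{cases}$$ Substituting these sums for $f(x,i,h(x,y))$ into the formula for $d(x,y,S)$ and expanding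 (over $i$, $k$ and $l$) gives $d(x,y,S)$ as a sum of explicit products, and there is an absolute constant $C$ such that the number of summands is at most $C|x|^3$ for all $x,y,S$ with $|y|\ge|x|\ge1$. -/

import Mathlib

/-- The two letters of the alphabet `{1, 2}`. -/
inductive Digit where
  | one
  | two
  deriving DecidableEq

namespace Digit

/-- The numerical value of a digit. -/
def val : Digit → ℕ
  | one => 1
  | two => 2

end Digit

/-- The vertices of the Young–Fibonacci graph: words over `{1, 2}`, the leftmost digit being the
head of the list. The number of digits `#x` is `x.length`. -/
abbrev YFWord := List Digit

namespace YF

open Digit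

/-- The digit sum `|x|`, which is the rank of `x` in the graph. -/
def rank (x : YFWord) : ℕ := (x.map Digit.val).sum

/-- The number of twos `d(x)`. -/
def numTwos (x : YFWord) : ℕ := x.count two

/-! ### The Young–Fibonacci graph -/

/-- The upward edges. From a word one either replaces its leftmost one by a two, or inserts a one
somewhere to the left of its leftmost one (anywhere, if the word has no ones). In both cases every
digit to the left of the affected place is a two. -/
inductive Up : YFWord → YFWord → Prop
  | replace (k : ℕ) (u : YFWord) :
      Up (List.replicate k two ++ one :: u) (List.replicate k two ++ two :: u)
  | insert (k : ℕ) (u : YFWord) :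
      Up (List.replicate k two ++ u) (List.replicate k two ++ one :: u)

theorem rank_append (x y : YFWord) : rank (x ++ y) = rank x + rank y := by
  simp [rank]

theorem rank_cons (a : Digit) (x : YFWord) : rank (a :: x) = a.val + rank x := by
  simp [rank]

theorem Up.rank_eq {x y : YFWord} (h : Up x y) : rank y = rank x + 1 := by
  cases h <;> simp [rank_append, rank_cons, Digit.val] <;> omega

/-- The Young–Fibonacci graph. -/
def graph : SimpleGraph YFWord where
  Adj x y := Up x y ∨ Up y x
  symm := ⟨fun _ _ h => h.symm⟩
  loopless := ⟨fun x h => by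
    rcases h with h | h <;> exact absurd h.rank_eq (by omega)⟩

/-- The number of up-steps of a path, i.e. of steps from a vertex to one of greater rank. -/
def upSteps {y x : YFWord} (w : graph.Walk y x) : ℕ :=
  w.darts.countP fun e => decide (rank e.fst < rank e.snd)

/-- The set of paths from `y` to `x` (vertices may repeat) with exactly `S` up-steps. -/
def sPaths (x y : YFWord) (S : ℕ) : Set (graph.Walk y x) := {w | upSteps w = S}

/-- The number `d(x, y, S)` of paths from `y` to `x` with exactly `S` up-steps. -/
noncomputable def numPaths (x y : YFWord) (S : ℕ) : ℕ := (sPaths x y S).ncard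

/-! ### The common suffix -/

/-- The length of the longest common prefix of two words. -/
def commonPrefixLen : YFWord → YFWord → ℕ
  | a :: x, b :: y => if a = b then commonPrefixLen x y + 1 else 0
  | _, _ => 0

/-- `h(x, y)`: the number of digits of the longest common suffix of `x` and `y`. -/
def h (x y : YFWord) : ℕ := commonPrefixLen x.reverse y.reverse

theorem commonPrefixLen_isGreatest (x y : YFWord) :
    IsGreatest {n | ∃ u : YFWord, u <+: x ∧ u <+: y ∧ u.length = n} (commonPrefixLen x y) := by
  induction x generalizing y with
  | nil =>
    refine ⟨⟨[], by simp, by simp, by simp [commonPrefixLen]⟩, ?_⟩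
    rintro n ⟨u, h1, -, rfl⟩
    simp [List.prefix_nil.mp h1]
  | cons a x ih =>
    cases y with
    | nil =>
      refine ⟨⟨[], by simp, by simp, by simp [commonPrefixLen]⟩, ?_⟩
      rintro n ⟨u, -, h2, rfl⟩
      simp [List.prefix_nil.mp h2]
    | cons b y =>
      obtain ⟨⟨v, hv1, hv2, hv3⟩, hmax⟩ := ih y
      by_cases hab : a = b
      · subst hab
        refine ⟨⟨a :: v, by simpa using hv1, by simpa using hv2, by
          simp [commonPrefixLen, hv3]⟩, ?_⟩
        rintro n ⟨u, h1, h2, rfl⟩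
        cases u with
        | nil => simp
        | cons c u =>
          rw [List.cons_prefix_cons] at h1 h2
          have := hmax ⟨u, h1.2, h2.2, rfl⟩
          simpa [commonPrefixLen] using this
      · refine ⟨⟨[], by simp, by simp, by simp [commonPrefixLen, hab]⟩, ?_⟩
        rintro n ⟨u, h1, h2, rfl⟩
        cases u with
        | nil => simp
        | cons c u =>
          rw [List.cons_prefix_cons] at h1 h2
          exact absurd (h1.1.symm.trans h2.1) hab

theorem h_isGreatest (x y : YFWord) :
    IsGreatest {n | ∃ u : YFWord, u <:+ x ∧ u <:+ y ∧ u.length = n} (h x y) := by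
  obtain ⟨⟨v, hv1, hv2, hv3⟩, hmax⟩ := commonPrefixLen_isGreatest x.reverse y.reverse
  refine ⟨⟨v.reverse, by simpa using List.reverse_suffix.mpr hv1,
    by simpa using List.reverse_suffix.mpr hv2, by simpa [h] using hv3⟩, ?_⟩
  rintro n ⟨u, h1, h2, rfl⟩
  exact hmax ⟨u.reverse, List.reverse_prefix.mpr h1, List.reverse_prefix.mpr h2, by simp⟩

/-! ### The lower function -/

/-- For `u = α₁ … αₘ` and `v = αₘ₊₁ … αₙ`, the number
`1 / ((-αₘ₊₁)(-αₘ₊₁ - αₘ₊₂) ⋯ (-αₘ₊₁ - ⋯ - αₙ)) * 1 / (αₘ (αₘ + αₘ₋₁) ⋯ (αₘ + ⋯ + α₁))`. -/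
def splitValue (u v : YFWord) : ℚ :=
  1 / (∏ k ∈ Finset.range v.length, (-(rank (v.take (k + 1)) : ℚ))) *
    (1 / ∏ k ∈ Finset.range u.length, (rank (u.drop k) : ℚ))

/-- The lower function at `z = 0`: it is `splitValue u v` if `x = uv` with `|v| = y`, and `0` if
there is no such factorization. There is at most one, so the sum has at most one term. -/
def fZero (x : YFWord) (y : ℕ) : ℚ :=
  ∑ m ∈ (Finset.range (x.length + 1)).filter (fun m => rank (x.drop m) = y),
    splitValue (x.take m) (x.drop m)

theorem val_pos (a : Digit) : 0 < a.val := by cases a <;> simp [Digit.val]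

theorem rank_drop_injOn (x : YFWord) {m n : ℕ} (hm : m ≤ x.length) (hn : n ≤ x.length)
    (e : rank (x.drop m) = rank (x.drop n)) : m = n := by
  induction x generalizing m n with
  | nil => simp at hm hn; omega
  | cons a x ih =>
    have key : ∀ k, rank (x.drop k) ≤ rank x := by
      intro k
      conv_rhs => rw [← List.take_append_drop k x, rank_append]
      omega
    have ha := val_pos a
    cases m with
    | zero =>
      cases n with
      | zero => rfl
      | succ n =>
        have := key n
        simp [rank_cons] at e
        omega
    | succ m =>
      cases n with
      | zero =>
        have := key m
        simp [rank_cons] at e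
        omega
      | succ n =>
        simp only [List.length_cons, Nat.add_le_add_iff_right, List.drop_succ_cons] at hm hn e
        rw [ih hm hn e]

theorem fZero_append (u v : YFWord) : fZero (u ++ v) (rank v) = splitValue u v := by
  have : (Finset.range ((u ++ v).length + 1)).filter
      (fun m => rank ((u ++ v).drop m) = rank v) = {u.length} := by
    ext m
    simp only [Finset.mem_filter, Finset.mem_range, Finset.mem_singleton]
    constructor
    · rintro ⟨h1, h2⟩
      exact rank_drop_injOn (u ++ v) (by omega) (by simp) (by simpa using h2)
    · rintro rfl
      simp
  rw [fZero, this]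
  simp

theorem fZero_eq_zero (x : YFWord) (y : ℕ)
    (hn : ¬ ∃ u v : YFWord, x = u ++ v ∧ rank v = y) : fZero x y = 0 := by
  rw [fZero, Finset.filter_eq_empty_iff.mpr, Finset.sum_empty]
  exact fun m _ e => hn ⟨x.take m, x.drop m, (List.take_append_drop m x).symm, e⟩

/-- The lower function on words written from right to left. -/
def fRev : YFWord → ℕ → ℕ → ℚ
  | w, y, 0 => fZero w.reverse y
  | [], _, _ + 1 => 0
  | one :: w, 0, _ + 1 => fZero (one :: w).reverse 0
  | one :: w, y + 1, z + 1 => fZero (one :: w).reverse (y + 1) + fRev w y z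
  | two :: w, y, z + 1 => if y = 1 then 0 else fRev (one :: one :: w) y (z + 2) / (1 - (y : ℚ))
termination_by w => w.length + 2 * w.count two
decreasing_by
  all_goals simp <;> omega

/-- The lower function `f(x, y, z)`, for `0 ≤ y ≤ |x|` and `0 ≤ z ≤ #x`. The lemmas below give its
defining equations. -/
def f (x : YFWord) (y z : ℕ) : ℚ := fRev x.reverse y z

theorem f_zero (x : YFWord) (y : ℕ) : f x y 0 = fZero x y := by
  simp [f, fRev]

theorem f_one_zero (x : YFWord) (z : ℕ) : f (x ++ [one]) 0 (z + 1) = f (x ++ [one]) 0 0 := by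
  simp [f, fRev]

theorem f_one_succ (x : YFWord) (y z : ℕ) :
    f (x ++ [one]) (y + 1) (z + 1) = f (x ++ [one]) (y + 1) 0 + f x y z := by
  simp [f, fRev]

theorem f_two (x : YFWord) (y z : ℕ) :
    f (x ++ [two]) y (z + 1) =
      if y = 1 then 0 else f (x ++ [one, one]) y (z + 2) / (1 - (y : ℚ)) := by
  simp [f, fRev]

/-! ### The upper function -/

/-- The lengths of the blocks of ones, on words written from right to left. -/
def betaRev : YFWord → ℕ → ℕ
  | [], _ => 0
  | one :: w, 0 => betaRev w 0 + 1
  | one :: w, i + 1 => betaRev w (i + 1)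
  | two :: _, 0 => 0
  | two :: w, i + 1 => betaRev w i

/-- `βᵢ`, where `x = 1^{β_{d(x)}} 2 ⋯ 2 1^{β₁} 2 1^{β₀}`. -/
def beta (x : YFWord) (i : ℕ) : ℕ := betaRev x.reverse i

/-- The upper function `g(x, m) = β₀ + ⋯ + βₘ₋₁ + 2m - 1`, for `1 ≤ m ≤ d(x)`. -/
def g (x : YFWord) (m : ℕ) : ℤ := ∑ i ∈ Finset.range m, (beta x i : ℤ) + 2 * m - 1

/-- `∏_{j = 1}^{d(y)} (g(y, j) - i)`. -/
def gProd (y : YFWord) (i : ℕ) : ℚ :=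
  ∏ j ∈ Finset.Icc 1 (numTwos y), ((g y j : ℚ) - (i : ℚ))

/-- `F(x, y, i) = f(x, i, h(x, y)) ∏_j (g(y, j) - i)`. -/
def F (x y : YFWord) (i : ℕ) : ℚ := f x i (h x y) * gProd y i

/-! ### The coefficients -/

/-- `m(X, S) = min {⌊X / 2⌋, S}`. -/
def m (X S : ℕ) : ℕ := min (X / 2) S

/-- `(-1)^k C(X, 2k) (2k - 1)!! C(Y + 2S - 2k, Y) (2S - 2k - 1)!!`, with `(-1)!! = 1`: the truncated
difference `0 - 1` is `0`, and `0!! = 1`. It is used for `k ≤ S` only. -/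
def coeff (X Y S k : ℕ) : ℚ :=
  (-1) ^ k * (X.choose (2 * k) : ℚ) * (Nat.doubleFactorial (2 * k - 1) : ℚ) *
    ((Y + 2 * S - 2 * k).choose Y : ℚ) * (Nat.doubleFactorial (2 * S - 2 * k - 1) : ℚ)

/-! ### The explicit form of the lower function, and the expanded formula -/

/-- `p(x, z)`: the sum of the last `z` digits of `x`. -/
def p (x : YFWord) (z : ℕ) : ℕ := rank (x.drop (x.length - z))

/-- The function `s` on words written from right to left. -/
def sRev : YFWord → ℕ → YFWord
  | [], _ => []
  | one :: w, 0 => one :: w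
  | two :: w, 0 => one :: one :: w
  | one :: w, a + 1 => sRev w a
  | two :: w, 1 => one :: w
  | two :: w, a + 2 => sRev w a

/-- The beginning `s(x, a)` of `x`, for `0 ≤ a ≤ |x|`: it is `u1` if `x = u1v` with `|v| = a`, it is
`u11` if `x = u2v` with `|v| = a`, it is `u1` if `x = u2v` with `|v| = a - 1`, and it is empty if
`a = |x|`. -/
def s (x : YFWord) (a : ℕ) : YFWord := (sRev x.reverse a).reverse

/-- `∏ (g(x, j) - y)` over the `j` in `{1, …, d(x)}` with `g(x, j) ≤ b`. -/
def gDenom (x : YFWord) (y b : ℕ) : ℚ :=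
  ∏ j ∈ (Finset.Icc 1 (numTwos x)).filter (fun j => g x j ≤ (b : ℤ)), ((g x j : ℚ) - (y : ℚ))

/-- The number of summands in the explicit form of `f(x, y, z)`. -/
def fCount (x : YFWord) (y z : ℕ) : ℕ :=
  if y = 0 then 1 else if p x z < y then p x z + 1 else y - 1

/-- The `l`-th summand in the explicit form of `f(x, y, z)`, for `0 ≤ l < fCount x y z`. The word
`x.take (x.length - z)` is `x` without its last `z` digits. -/
def fTerm (x : YFWord) (y z l : ℕ) : ℚ :=
  if y = 0 then fZero x 0
  else if l < p x z then fZero (s x l) (y - l) / gDenom x y (l + 1)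
  else fZero (x.take (x.length - z)) (y - l) / gDenom x y l

/-- The index set `{(i, k, l)}` of the expanded formula for `d(x, y, S)`. -/
def explicitIndex (x y : YFWord) (S : ℕ) : Finset (Σ _ : ℕ, ℕ × ℕ) :=
  (Finset.range (rank x + 1)).sigma fun i =>
    Finset.range (m (rank x - i) S + 1) ×ˢ Finset.range (fCount x i (h x y))

/-- The summands of the expanded formula for `d(x, y, S)`. -/
def explicitTerm (x y : YFWord) (S : ℕ) (t : Σ _ : ℕ, ℕ × ℕ) : ℚ :=
  coeff (rank x - t.1) (rank y - t.1) S t.2.1 * fTerm x t.1 (h x y) t.2.2 * gProd y t.1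

end YF

/-! A path from `y` to `x` with `S` up-steps is a reversed walk of length `n = |y| - |x| + 2S` from
`x` to `y`. As a function of `x`, the number of such walks starts as the indicator of `y`, and each
step replaces it by its sum over the words covered by `x` plus its sum over the words covering `x`.

This recursion separates. For `i ≤ |y|` the function `component y i`, zero below rank `i`,
satisfies: its sum over the words covering `x` is its value at `x`, and its sum over the words
covered by `x` is `|x| - i` times that value (`sum_up_component`, `sum_down_component`). Multiplied
by `c(X)` with `X = |x| - i`, it is sent to itself times `c(X+1) + X c(X-1)`. Since `z He_X =
He_{X+1} + X He_{X-1}` for Hermite polynomials, the right factor is the coefficient of `He_{|y|-i}`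
in `z^n He_{|x|-i}`; expanding `He` in powers and powers in `He` gives the inner sum of the theorem.

Three facts about `F` remain. Above rank `i` it obeys the recursion defining the components
(`component_eq_F`). At rank `i` its sum over the words covering any word of rank `i - 1` is zero:
either the upper product vanishes at `i`, or `y` has a suffix of digit sum `i` and `sum_up_topValue`
applies. Finally `∑ i, F x y i` is `1` or `0` according to `x = y` or not, when `|x| = |y|`
(`sum_F_eq_ite`). For the last, `fZero x i` is the product of `1 / (t - i)` over the suffix sums `t
≠ i` of `x`, so that `∑ i, fZero x i * φ i` is up to sign a divided difference of `φ` at `#x + 1`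
nodes and kills polynomials of degree below `#x`.

The explicit form of `f` comes from unrolling its recursion (`f_eq_sum`). -/

namespace YF

/-! ### Hermite polynomials: connection coefficients. -/

open Finset

/-- The connection coefficients between powers and Hermite polynomials,
`z ^ m = ∑ Y, powCoeff m Y * He_Y`. -/
def powCoeff : ℕ → ℕ → ℚ
  | 0, Y => if Y = 0 then 1 else 0
  | m + 1, 0 => powCoeff m 1
  | m + 1, Y + 1 => powCoeff m Y + (Y + 2) * powCoeff m (Y + 2)

theorem powCoeff_eq_zero_of_lt {m Y : ℕ} (h : m < Y) : powCoeff m Y = 0 := by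
  induction m generalizing Y with
  | zero => simp [powCoeff]; omega
  | succ m ih =>
    cases Y with
    | zero => omega
    | succ Y => rw [powCoeff, ih (by omega), ih (by omega)]; simp

theorem choose_mul_doubleFactorial (X k : ℕ) :
    ((X + 1).choose (2 * k + 1) : ℚ) * (Nat.doubleFactorial (2 * k + 1) : ℚ) =
      (X + 1) * (X.choose (2 * k) * (Nat.doubleFactorial (2 * k - 1) : ℚ)) := by
  have h1 : (Nat.doubleFactorial (2 * k + 1) : ℚ) =
      (2 * k + 1) * (Nat.doubleFactorial (2 * k - 1) : ℚ) := by
    cases k with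
    | zero => simp
    | succ k =>
      have : 2 * (k + 1) + 1 = (2 * k + 1) + 2 := by ring
      rw [this, Nat.doubleFactorial_add_two]
      push_cast
      rw [show 2 * (k + 1) - 1 = 2 * k + 1 by omega]
      ring
  have h2 : ((X : ℚ) + 1) * X.choose (2 * k) = (X + 1).choose (2 * k + 1) * (2 * k + 1) := by
    exact_mod_cast Nat.add_one_mul_choose_eq X (2 * k)
  rw [h1]
  linear_combination -(Nat.doubleFactorial (2 * k - 1) : ℚ) * h2

/-- Combinatorially, choose the `Y` points that stay free and match the other `2j` in pairs; the
proof checks the recurrence coming from `z He_Y = He_{Y+1} + Y He_{Y-1}`. -/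
theorem powCoeff_add_two_mul (Y j : ℕ) :
    powCoeff (Y + 2 * j) Y = ((Y + 2 * j).choose Y : ℚ) * (Nat.doubleFactorial (2 * j - 1) : ℚ) := by
  obtain ⟨m, hm⟩ : ∃ m, m = Y + 2 * j := ⟨_, rfl⟩
  induction m generalizing Y j with
  | zero =>
    obtain rfl : Y = 0 := by omega
    obtain rfl : j = 0 := by omega
    simp [powCoeff]
  | succ m ih =>
    cases Y with
    | zero =>
      obtain ⟨j, rfl⟩ : ∃ i, j = i + 1 := ⟨j - 1, by omega⟩
      rw [show 0 + 2 * (j + 1) = (1 + 2 * j) + 1 by ring, powCoeff, ih 1 j (by omega)]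
      rw [show 2 * (j + 1) - 1 = 2 * j + 1 by omega]
      have := choose_mul_doubleFactorial (2 * j) j
      simp only [Nat.choose_one_right, Nat.choose_zero_right, Nat.choose_self,
        add_comm 1 (2 * j)] at this ⊢
      rw [this]
      push_cast
      ring
    | succ Y =>
      rw [show Y + 1 + 2 * j = (Y + 2 * j) + 1 by ring, powCoeff, ih Y j (by omega)]
      cases j with
      | zero => rw [powCoeff_eq_zero_of_lt (by omega)]; simp
      | succ j =>
        rw [show Y + 2 * (j + 1) = Y + 2 + 2 * j by ring, ih (Y + 2) j (by omega),
          Nat.choose_succ_succ]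
        have e1 : (Y + 2 + 2 * j).choose (Y + 1) = (Y + 2 + 2 * j).choose (2 * j + 1) := by
          rw [← Nat.choose_symm (by omega)]; congr 1; omega
        have e2 : ((Y + 2 + 2 * j).choose (Y + 2) : ℚ) * (Y + 2) =
            (Y + 2 + 2 * j).choose (Y + 1) * (2 * j + 1) := by
          have := Nat.choose_succ_right_eq (Y + 2 + 2 * j) (Y + 1)
          rw [show Y + 2 + 2 * j - (Y + 1) = 2 * j + 1 by omega] at this
          exact_mod_cast this
        have e3 : (Nat.doubleFactorial (2 * (j + 1) - 1) : ℚ) =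
            (2 * j + 1) * Nat.doubleFactorial (2 * j - 1) := by
          have := choose_mul_doubleFactorial (2 * j) j
          rw [show 2 * (j + 1) - 1 = 2 * j + 1 by omega]
          simpa using this
        rw [e3]
        push_cast
        linear_combination (Nat.doubleFactorial (2 * j - 1) : ℚ) * e2

theorem powCoeff_succ_zero (m : ℕ) : powCoeff (m + 1) 0 = powCoeff m 1 := by rw [powCoeff]

theorem powCoeff_succ_succ (m Y : ℕ) :
    powCoeff (m + 1) (Y + 1) = powCoeff m Y + (Y + 2) * powCoeff m (Y + 2) := by rw [powCoeff]

/-- The coefficient of `z ^ (X - 2 * k)` in the Hermite polynomial `He_X`. -/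
def heCoeff (X k : ℕ) : ℚ :=
  (-1) ^ k * (X.choose (2 * k) : ℚ) * (Nat.doubleFactorial (2 * k - 1) : ℚ)

theorem heCoeff_zero (X : ℕ) : heCoeff X 0 = 1 := by simp [heCoeff]

theorem heCoeff_eq_zero {X k : ℕ} (h : X < 2 * k) : heCoeff X k = 0 := by
  simp [heCoeff, Nat.choose_eq_zero_of_lt h]

/-- This is `He_{X+2} = z He_{X+1} - (X+1) He_X` read off coefficientwise. -/
theorem heCoeff_succ (X k : ℕ) :
    heCoeff (X + 2) (k + 1) = heCoeff (X + 1) (k + 1) - (X + 1) * heCoeff X k := by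
  have := choose_mul_doubleFactorial X k
  simp only [heCoeff]
  rw [show 2 * (k + 1) = (2 * k + 1) + 1 by ring, Nat.choose_succ_succ (X + 1)]
  simp only [Nat.add_sub_cancel, pow_succ]
  push_cast
  linear_combination -(-1) ^ k * this

/-- The coefficient of `He_Y` in `z ^ n * He_X`. -/
def hermiteCoeff (n X Y : ℕ) : ℚ :=
  ∑ k ∈ range (X + 1), heCoeff X k * powCoeff (n + X - 2 * k) Y

/-- Since `heCoeff X k` vanishes for `2k > X`, the bound is free. This aligns sums with different
`X`, and `K = X / 2 + 1` keeps the exponent from being truncated. -/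
theorem hermiteCoeff_eq_sum {n X Y K : ℕ} (h : X < 2 * K) :
    hermiteCoeff n X Y = ∑ k ∈ range K, heCoeff X k * powCoeff (n + X - 2 * k) Y := by
  have key : ∀ A B : ℕ, A ≤ B → X < 2 * A →
      ∑ k ∈ range A, heCoeff X k * powCoeff (n + X - 2 * k) Y =
        ∑ k ∈ range B, heCoeff X k * powCoeff (n + X - 2 * k) Y := by
    intro A B hAB hA
    apply sum_subset (by simpa using hAB)
    intro k _ hk
    rw [heCoeff_eq_zero (by simp at hk; omega), zero_mul]
  rcases le_total K (X + 1) with h1 | h1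
  · exact (key _ _ h1 h).symm
  · exact key _ _ h1 (by omega)

/-- One factor `z` is absorbed into `He_X` by the three-term recurrence. -/
theorem hermiteCoeff_succ (n X Y : ℕ) :
    hermiteCoeff (n + 1) X Y = hermiteCoeff n (X + 1) Y + X * hermiteCoeff n (X - 1) Y := by
  cases X with
  | zero => simp [hermiteCoeff, sum_range_succ, heCoeff_zero, heCoeff_eq_zero]
  | succ X =>
    rw [hermiteCoeff_eq_sum (K := X + 3) (by omega), hermiteCoeff_eq_sum (X := X + 1 + 1)
      (K := X + 3) (by omega), hermiteCoeff_eq_sum (X := X + 1 - 1) (K := X + 2) (by omega),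
      sum_range_succ' _ (X + 2), sum_range_succ' _ (X + 2), mul_sum]
    rw [add_right_comm _ (heCoeff (X + 1 + 1) 0 * _), ← sum_add_distrib]
    congr 1
    · apply sum_congr rfl
      intro k _
      rw [heCoeff_succ]
      simp only [Nat.add_sub_cancel]
      rw [show n + 1 + (X + 1) - 2 * (k + 1) = n + X - 2 * k by omega,
        show n + (X + 1 + 1) - 2 * (k + 1) = n + X - 2 * k by omega]
      push_cast
      ring
    · rw [heCoeff_zero, heCoeff_zero]
      congr 2
      omega

/-- Here and in the next lemma the factor `z` acts on the expansion in the `He_Y` instead of on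
`He_X`. -/
theorem hermiteCoeff_one_zero (X : ℕ) : hermiteCoeff 1 X 0 = hermiteCoeff 0 X 1 := by
  rw [hermiteCoeff_eq_sum (K := X / 2 + 1) (by omega), hermiteCoeff_eq_sum (K := X / 2 + 1)
    (by omega)]
  apply sum_congr rfl
  intro k hk
  rw [mem_range] at hk
  rw [show 1 + X - 2 * k = (0 + X - 2 * k) + 1 by omega, powCoeff_succ_zero]

theorem hermiteCoeff_one_succ (X Y : ℕ) :
    hermiteCoeff 1 X (Y + 1) = hermiteCoeff 0 X Y + (Y + 2) * hermiteCoeff 0 X (Y + 2) := by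
  rw [hermiteCoeff_eq_sum (K := X / 2 + 1) (by omega), hermiteCoeff_eq_sum (K := X / 2 + 1)
    (by omega), hermiteCoeff_eq_sum (K := X / 2 + 1) (by omega), mul_sum, ← sum_add_distrib]
  apply sum_congr rfl
  intro k hk
  rw [mem_range] at hk
  rw [show 1 + X - 2 * k = (0 + X - 2 * k) + 1 by omega, powCoeff_succ_succ]
  ring

/-- The two passages between powers and Hermite polynomials are inverse. Computing `z He_X` in both
ways gives the induction step. -/
theorem hermiteCoeff_zero (X Y : ℕ) : hermiteCoeff 0 X Y = if X = Y then 1 else 0 := by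
  induction X using Nat.strong_induction_on generalizing Y with
  | _ X ih =>
    cases X with
    | zero => simp [hermiteCoeff, powCoeff, heCoeff_zero, eq_comm]
    | succ X =>
      have h := hermiteCoeff_succ 0 X Y
      rw [zero_add] at h
      have h' : hermiteCoeff 0 (X + 1) Y = hermiteCoeff 1 X Y - X * hermiteCoeff 0 (X - 1) Y := by
        rw [h]; ring
      rw [h', ih (X - 1) (by omega)]
      cases Y with
      | zero =>
        rw [hermiteCoeff_one_zero, ih X (by omega)]
        rcases X with _ | _ | X <;> simp
      | succ Y =>
        rw [hermiteCoeff_one_succ, ih X (by omega), ih X (by omega)]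
        by_cases h1 : X = Y
        · subst h1
          rcases X with _ | X
          · simp
          · simp; omega
        · by_cases h2 : X = Y + 2
          · subst h2
            simp
          · rw [if_neg h1, if_neg h2, if_neg (by omega)]
            rcases X with _ | X
            · simpa using Ne.symm h1
            · rw [if_neg (by omega)]; simp

theorem sum_coeff_eq_hermiteCoeff {X Y S n : ℕ} (hn : n + X = Y + 2 * S) :
    ∑ k ∈ range (m X S + 1), coeff X Y S k = hermiteCoeff n X Y := by
  rw [hermiteCoeff_eq_sum (K := X / 2 + 1) (by omega)]
  have hm : m X S ≤ X / 2 := min_le_left _ _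
  symm
  rw [← sum_subset (s₁ := range (m X S + 1)) (by
    intro k hk; rw [mem_range] at hk ⊢; omega)]
  · apply sum_congr rfl
    intro k hk
    have hk' : k ≤ S := by
      rw [mem_range] at hk
      have : m X S ≤ S := min_le_right _ _
      omega
    rw [show n + X - 2 * k = Y + 2 * (S - k) by omega, powCoeff_add_two_mul, coeff, heCoeff,
      show Y + 2 * S - 2 * k = Y + 2 * (S - k) by omega,
      show 2 * S - 2 * k - 1 = 2 * (S - k) - 1 by omega]
    ring
  · intro k hk hk'
    rw [mem_range] at hk hk'
    -- For these `k` the exponent `Y + 2S - 2k` is below `Y`, so `He_Y` does not occur.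
    have : S < k := by
      unfold m at hk'
      omega
    rw [powCoeff_eq_zero_of_lt (by omega), mul_zero]

end YF
-- Neighbours in the graph and walks of given length.
namespace YF

open Digit Finset

theorem cons_injective (a : Digit) : Function.Injective (fun v : YFWord => a :: v) :=
  fun _ _ e => (List.cons.inj e).2

/-- The words covered by a word. -/
def down : YFWord → Finset YFWord
  | [] => ∅
  | one :: w => {w}
  | two :: w => insert (one :: w) ((down w).map ⟨_, cons_injective two⟩)

/-- The words covering a word. -/
def up (w : YFWord) : Finset YFWord :=
  insert (one :: w) ((down w).map ⟨_, cons_injective two⟩)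

/-- The reflection property of the graph; it passes from sums over `up w` to sums over `down (two ::
w)`. -/
theorem down_two (w : YFWord) : down (two :: w) = up w := by rw [down, up]

theorem sum_up {M : Type*} [AddCommMonoid M] (w : YFWord) (φ : YFWord → M) :
    ∑ v ∈ up w, φ v = φ (one :: w) + ∑ v ∈ down w, φ (two :: v) := by
  rw [up, sum_insert (by simp), sum_map]
  rfl

theorem up_nil_iff (v : YFWord) : ¬ Up v [] := by
  intro hv
  have := hv.rank_eq
  simp [rank] at this

theorem up_one_iff (v w : YFWord) : Up v (one :: w) ↔ v = w := by
  constructor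
  · generalize hx : one :: w = x
    rintro (⟨k, u⟩ | ⟨k, u⟩)
    · cases k <;> simp [List.replicate_succ] at hx
    · cases k <;> simp [List.replicate_succ] at hx
      simp [hx]
  · rintro rfl
    exact Up.insert 0 v

theorem up_two_iff (v w : YFWord) :
    Up v (two :: w) ↔ v = one :: w ∨ ∃ u, Up u w ∧ two :: u = v := by
  constructor
  · generalize hx : two :: w = x
    rintro (⟨k, u⟩ | ⟨k, u⟩)
    · cases k with
      | zero => simp at hx; simp [hx]
      | succ k =>
        simp [List.replicate_succ] at hx
        subst hx
        exact Or.inr ⟨_, Up.replace k u, by simp [List.replicate_succ]⟩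
    · cases k with
      | zero => simp at hx
      | succ k =>
        simp [List.replicate_succ] at hx
        subst hx
        exact Or.inr ⟨_, Up.insert k u, by simp [List.replicate_succ]⟩
  · rintro (rfl | ⟨u, hu, rfl⟩)
    · exact Up.replace 0 w
    · rcases hu with ⟨k, u⟩ | ⟨k, u⟩
      · exact Up.replace (k + 1) u
      · exact Up.insert (k + 1) u

theorem mem_down {v x : YFWord} : v ∈ down x ↔ Up v x := by
  induction x generalizing v with
  | nil => simp [down, up_nil_iff]
  | cons a w ih =>
    cases a with
    | one => simp [down, up_one_iff]
    | two => simp [down, up_two_iff, ih]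

theorem mem_up {v x : YFWord} : v ∈ up x ↔ Up x v := by
  induction x generalizing v with
  | nil =>
    rcases v with _ | ⟨b, v⟩
    · simp [up, down, up_nil_iff]
    · cases b <;> simp [up, down, up_one_iff, up_two_iff, eq_comm]
  | cons a x ih =>
    rcases v with _ | ⟨b, v⟩
    · simp [up, up_nil_iff]
    · cases b with
      | one => rw [up_one_iff, eq_comm (a := a :: x)]; simp [up]
      | two =>
        rw [up_two_iff]
        cases a with
        | one => simp [up, down, eq_comm]
        | two =>
          have : ∀ u : YFWord, two :: u ∈ up (two :: x) ↔ u ∈ up x := by simp [up, down_two]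
          rw [this, ih]
          simp

theorem rank_of_mem_down {v x : YFWord} (hv : v ∈ down x) : rank x = rank v + 1 :=
  (mem_down.mp hv).rank_eq

theorem rank_of_mem_up {v x : YFWord} (hv : v ∈ up x) : rank v = rank x + 1 :=
  (mem_up.mp hv).rank_eq

theorem disjoint_down_up (x : YFWord) : Disjoint (down x) (up x) := by
  rw [disjoint_left]
  intro v h1 h2
  have := rank_of_mem_down h1
  have := rank_of_mem_up h2
  omega

theorem adj_iff {x v : YFWord} : graph.Adj x v ↔ v ∈ down x ∪ up x := by
  rw [mem_union, mem_down, mem_up]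
  exact or_comm

/-- Every step changes the rank by one, so endpoints and length determine the number of up-steps. -/
theorem two_mul_upSteps {y x : YFWord} (w : graph.Walk y x) :
    2 * upSteps w + rank y = w.length + rank x := by
  induction w with
  | nil => simp [upSteps]
  | @cons a b c hab w ih =>
    have e : upSteps (SimpleGraph.Walk.cons hab w) =
        upSteps w + if rank a < rank b then 1 else 0 := by
      simp [upSteps, List.countP_cons]
    rw [e, SimpleGraph.Walk.length_cons]
    rcases hab with hab | hab
    · have := hab.rank_eq
      rw [if_pos (by omega)]; omega
    · have := hab.rank_eq
      rw [if_neg (by omega)]; omega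

/-- The walks of length `n` from `x` to `y`. -/
def walks (y : YFWord) : ℕ → (x : YFWord) → Set (graph.Walk x y) := fun n _ => {w | w.length = n}

theorem walks_succ (x y : YFWord) (n : ℕ) :
    walks y (n + 1) x = ⋃ v : {v // v ∈ down x ∪ up x},
      (SimpleGraph.Walk.cons (adj_iff.mpr v.2)) '' walks y n v.1 := by
  ext w
  simp only [walks, Set.mem_ofPred_eq, Set.mem_iUnion, Set.mem_image]
  constructor
  · intro hw
    cases w with
    | nil => simp at hw
    | @cons _ v _ hv w => exact ⟨⟨v, adj_iff.mp hv⟩, w, by simpa using hw, rfl⟩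
  · rintro ⟨v, w, hw, rfl⟩
    simp [hw]

theorem finite_walks (y : YFWord) (n : ℕ) (x : YFWord) : (walks y n x).Finite := by
  induction n generalizing x with
  | zero =>
    apply Set.Subsingleton.finite
    intro w hw w' hw'
    cases w with
    | nil =>
      cases w' with
      | nil => rfl
      | cons => simp [walks] at hw'
    | cons => simp [walks] at hw
  | succ n ih =>
    rw [walks_succ]
    exact Set.finite_iUnion fun v => (ih v.1).image _

theorem ncard_walks_zero (x y : YFWord) : (walks y 0 x).ncard = if x = y then 1 else 0 := by
  split_ifs with hxy
  · subst hxy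
    rw [Set.ncard_eq_one]
    refine ⟨.nil, ?_⟩
    ext w
    simp [walks, SimpleGraph.Walk.length_eq_zero_iff]
  · rw [Set.ncard_eq_zero (finite_walks y 0 x)]
    ext w
    simp only [walks, Set.mem_ofPred_eq, Set.mem_empty_iff_false, iff_false]
    intro hw
    exact hxy (SimpleGraph.Walk.eq_of_length_eq_zero hw)

theorem ncard_walks_succ (x y : YFWord) (n : ℕ) :
    (walks y (n + 1) x).ncard =
      ∑ v ∈ down x, (walks y n v).ncard + ∑ v ∈ up x, (walks y n v).ncard := by
  rw [← sum_union (disjoint_down_up x), ← Finset.sum_coe_sort, walks_succ,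
    Set.ncard_iUnion_of_finite, finsum_eq_sum_of_fintype]
  · apply sum_congr rfl
    intro v _
    apply Set.ncard_image_of_injective
    intro w w' e
    simpa using e
  · exact fun v => (finite_walks y n v.1).image _
  · intro u v huv
    rw [Function.onFun, Set.disjoint_left]
    rintro _ ⟨w, -, rfl⟩ ⟨w', -, e⟩
    apply huv
    simp only [SimpleGraph.Walk.cons.injEq] at e
    exact Subtype.ext e.1.symm

theorem sPaths_eq {x y : YFWord} {S n : ℕ} (hn : n + rank x = rank y + 2 * S) :
    sPaths x y S = SimpleGraph.Walk.reverse '' walks y n x := by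
  ext w
  have := two_mul_upSteps w
  simp only [sPaths, walks, Set.mem_ofPred_eq, Set.mem_image]
  constructor
  · intro hw
    exact ⟨w.reverse, by rw [SimpleGraph.Walk.length_reverse]; omega, w.reverse_reverse⟩
  · rintro ⟨w', hw', rfl⟩
    rw [SimpleGraph.Walk.length_reverse] at this
    omega

theorem finite_sPaths {x y : YFWord} (S : ℕ) (h : rank x ≤ rank y) : (sPaths x y S).Finite := by
  rw [sPaths_eq (n := rank y + 2 * S - rank x) (by omega)]
  exact (finite_walks _ _ _).image _

theorem numPaths_eq {x y : YFWord} {S n : ℕ} (hn : n + rank x = rank y + 2 * S) :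
    numPaths x y S = (walks y n x).ncard := by
  rw [numPaths, sPaths_eq hn]
  exact Set.ncard_image_of_injective _ SimpleGraph.Walk.reverse_injective

end YF
namespace YF

open Digit Finset

/-! ### Words from right to left -/

theorem rank_nil : rank [] = 0 := rfl

theorem rank_one_cons (x : YFWord) : rank (one :: x) = rank x + 1 := by
  rw [rank_cons]; simp [Digit.val]; omega

theorem rank_two_cons (x : YFWord) : rank (two :: x) = rank x + 2 := by
  rw [rank_cons]; simp [Digit.val]; omega

theorem rank_snoc (x : YFWord) (a : Digit) : rank (x ++ [a]) = rank x + a.val := by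
  simp [rank_append, rank_cons, rank_nil]

theorem rank_snoc_one (x : YFWord) : rank (x ++ [one]) = rank x + 1 := rank_snoc x one

theorem rank_snoc_two (x : YFWord) : rank (x ++ [two]) = rank x + 2 := rank_snoc x two

theorem length_le_rank (x : YFWord) : x.length ≤ rank x := by
  induction x with
  | nil => simp
  | cons a x ih =>
    have := val_pos a
    rw [rank_cons, List.length_cons]
    omega

theorem rank_le_two_mul_length (x : YFWord) : rank x ≤ 2 * x.length := by
  induction x with
  | nil => simp [rank_nil]
  | cons a x ih =>
    rw [List.length_cons]
    cases a
    · rw [rank_one_cons]; omega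
    · rw [rank_two_cons]; omega

theorem h_snoc (x y : YFWord) (a b : Digit) :
    h (x ++ [a]) (y ++ [b]) = if a = b then h x y + 1 else 0 := by
  simp [h, commonPrefixLen]

theorem h_nil_left (y : YFWord) : h [] y = 0 := by simp [h, commonPrefixLen]

theorem h_nil_right (x : YFWord) : h x [] = 0 := by
  unfold h
  cases x.reverse <;> rfl

theorem h_le_length (x y : YFWord) : h x y ≤ x.length := by
  obtain ⟨u, hu, -, e⟩ := (h_isGreatest x y).1
  rw [← e]
  exact hu.length_le

/-- A new leftmost digit can lengthen the common suffix only if all of `w` was common already. -/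
theorem h_cons (a : Digit) (w y : YFWord) :
    h (a :: w) y = h w y ∨ h w y = w.length ∧ h (a :: w) y = w.length + 1 := by
  induction w using List.reverseRecOn generalizing y with
  | nil =>
    rcases List.eq_nil_or_concat y with rfl | ⟨y, b, rfl⟩
    · simp [h_nil_right]
    · have := h_snoc [] y a b
      rw [List.nil_append] at this
      rw [List.concat_eq_append, this, h_nil_left, h_nil_left]
      split_ifs <;> simp
  | append_singleton w c ih =>
    rcases List.eq_nil_or_concat y with rfl | ⟨y, b, rfl⟩
    · simp [h_nil_right]
    · rw [List.concat_eq_append, ← List.cons_append, h_snoc, h_snoc]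
      split_ifs
      · rcases ih y with e | ⟨e1, e2⟩
        · simp [e]
        · simp [e1, e2]
      · simp

/-! ### The lower function at zero -/

theorem splitValue_cons (a : Digit) (u v : YFWord) :
    splitValue (a :: u) v * (rank (a :: u) : ℚ) = splitValue u v := by
  have : (rank (a :: u) : ℚ) ≠ 0 := by
    have := val_pos a
    rw [rank_cons]
    exact_mod_cast (by omega : a.val + rank u ≠ 0)
  simp only [splitValue, List.length_cons]
  rw [prod_range_succ' (fun k => (rank ((a :: u).drop k) : ℚ))]
  simp only [List.drop_succ_cons, List.drop_zero]
  field_simp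

theorem splitValue_snoc (a : Digit) (u v : YFWord) :
    splitValue u (v ++ [a]) * -((rank v + a.val : ℕ) : ℚ) = splitValue u v := by
  have h0 : ((rank v + a.val : ℕ) : ℚ) ≠ 0 := by
    have := val_pos a
    exact_mod_cast (by omega : rank v + a.val ≠ 0)
  have h1 : ∏ k ∈ range v.length, (-(rank ((v ++ [a]).take (k + 1)) : ℚ)) =
      ∏ k ∈ range v.length, (-(rank (v.take (k + 1)) : ℚ)) := by
    apply prod_congr rfl
    intro k hk
    rw [mem_range] at hk
    rw [List.take_append_of_le_length (by omega)]
  have h2 : (v ++ [a]).take (v.length + 1) = v ++ [a] := List.take_of_length_le (by simp)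
  simp only [splitValue, List.length_append, List.length_singleton]
  rw [prod_range_succ, h1, h2, rank_snoc]
  field_simp

theorem fZero_eq_zero_of_lt {x : YFWord} {i : ℕ} (h : rank x < i) : fZero x i = 0 := by
  apply fZero_eq_zero
  rintro ⟨u, v, rfl, rfl⟩
  rw [rank_append] at h
  omega

/-- The new digit adds the single node `|aw|`. The form without division includes `i = |aw|`, where
both sides vanish. -/
theorem fZero_cons (a : Digit) (w : YFWord) (i : ℕ) :
    fZero (a :: w) i * ((rank (a :: w) : ℚ) - i) = fZero w i := by
  by_cases hs : ∃ u v : YFWord, w = u ++ v ∧ rank v = i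
  · obtain ⟨u, v, rfl, rfl⟩ := hs
    rw [fZero_append, ← List.cons_append, fZero_append, ← splitValue_cons a u v, rank_append]
    push_cast
    ring
  · rw [fZero_eq_zero w i hs]
    by_cases hi : i = rank (a :: w)
    · simp [hi]
    · rw [fZero_eq_zero, zero_mul]
      rintro ⟨u, v, e, rfl⟩
      cases u with
      | nil => exact hi (by rw [e, List.nil_append])
      | cons b u =>
        rw [List.cons_append] at e
        exact hs ⟨u, v, (List.cons.inj e).2, rfl⟩

theorem fZero_cons_eq_div {a : Digit} {w : YFWord} {i : ℕ} (hi : i ≤ rank w) :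
    fZero (a :: w) i = fZero w i / ((rank (a :: w) : ℚ) - i) := by
  rw [← fZero_cons a w i, mul_div_cancel_right₀]
  have := val_pos a
  rw [rank_cons, sub_ne_zero]
  exact_mod_cast (by omega : a.val + rank w ≠ i)

/-- Appending a digit shifts all nodes by its value and adds the node `0`. -/
theorem fZero_snoc (a : Digit) (w : YFWord) (i : ℕ) :
    fZero (w ++ [a]) (i + a.val) * -((i + a.val : ℕ) : ℚ) = fZero w i := by
  by_cases hs : ∃ u v : YFWord, w = u ++ v ∧ rank v = i
  · obtain ⟨u, v, rfl, rfl⟩ := hs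
    rw [fZero_append, List.append_assoc, ← rank_snoc, fZero_append, rank_snoc, splitValue_snoc]
  · rw [fZero_eq_zero w i hs, fZero_eq_zero, zero_mul]
    rintro ⟨u, v, e, hv⟩
    rcases List.eq_nil_or_concat v with rfl | ⟨v, b, rfl⟩
    · have := val_pos a
      rw [rank_nil] at hv
      omega
    · rw [List.concat_eq_append] at e hv
      rw [← List.append_assoc] at e
      obtain ⟨e1, e2⟩ := List.append_inj' e rfl
      obtain rfl : a = b := by simpa using e2
      rw [rank_snoc] at hv
      exact hs ⟨u, v, e1, by omega⟩

theorem fZero_snoc_eq_div (a : Digit) (w : YFWord) (i : ℕ) :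
    fZero (w ++ [a]) (i + a.val) = -fZero w i / ((i + a.val : ℕ) : ℚ) := by
  have := val_pos a
  have h0 : ((i + a.val : ℕ) : ℚ) ≠ 0 := by exact_mod_cast (by omega : i + a.val ≠ 0)
  rw [← fZero_snoc a w i]
  field_simp

theorem fZero_snoc_one (w : YFWord) (i : ℕ) :
    fZero (w ++ [one]) (i + 1) = -fZero w i / (i + 1) := by
  simpa [Digit.val] using fZero_snoc_eq_div one w i

theorem fZero_snoc_two (w : YFWord) (i : ℕ) :
    fZero (w ++ [two]) (i + 2) = -fZero w i / (i + 2) := by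
  simpa [Digit.val] using fZero_snoc_eq_div two w i

theorem fZero_snoc_two_one (w : YFWord) : fZero (w ++ [two]) 1 = 0 := by
  apply fZero_eq_zero
  rintro ⟨u, v, e, hv⟩
  rcases List.eq_nil_or_concat v with rfl | ⟨v, b, rfl⟩
  · simp [rank_nil] at hv
  · rw [List.concat_eq_append] at e hv
    rw [← List.append_assoc] at e
    obtain ⟨e1, e2⟩ := List.append_inj' e rfl
    obtain rfl : two = b := by simpa using e2
    rw [rank_snoc_two] at hv
    omega

theorem fZero_nil_zero : fZero [] 0 = 1 := by
  simpa [splitValue, rank_nil] using fZero_append [] []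

/-- The only additional node of `x11` is `1`, which contributes the factor `1 / (1 - 0)`. -/
theorem fZero_snoc_two_zero (x : YFWord) : fZero (x ++ [two]) 0 = fZero (x ++ [one, one]) 0 := by
  induction x with
  | nil =>
    simp only [List.nil_append]
    rw [fZero_cons_eq_div (by simp), fZero_cons_eq_div (by simp), fZero_cons_eq_div (by simp)]
    simp [rank, Digit.val]
  | cons a x ih =>
    rw [List.cons_append, List.cons_append, fZero_cons_eq_div (by simp), fZero_cons_eq_div (by simp),
      ih]
    simp [rank_append, rank_cons, Digit.val, rank_nil]

theorem fZero_snoc_one_one_add (x : YFWord) : fZero (x ++ [one]) 1 + fZero x 0 = 0 := by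
  have := fZero_snoc_one x 0
  simp only [zero_add, Nat.cast_zero, div_one] at this
  rw [this]
  ring

/-! ### Divided differences -/

theorem sum_fZero_cons (a : Digit) (w : YFWord) (φ : ℕ → ℚ) {M : ℕ} :
    ∑ i ∈ range M, fZero (a :: w) i * (((rank (a :: w) : ℚ) - i) * φ i) =
      ∑ i ∈ range M, fZero w i * φ i := by
  apply sum_congr rfl
  intro i _
  rw [← mul_assoc, fZero_cons]

theorem sum_fZero_snoc (a : Digit) (w : YFWord) (M : ℕ) :
    ∑ i ∈ range (M + a.val), fZero (w ++ [a]) i * (i : ℚ) = -∑ i ∈ range M, fZero w i := by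
  have key : ∑ i ∈ range M, fZero (w ++ [a]) (i + a.val) * ((i + a.val : ℕ) : ℚ) =
      -∑ i ∈ range M, fZero w i := by
    rw [← sum_neg_distrib]
    apply sum_congr rfl
    intro i _
    rw [← fZero_snoc a w i]
    ring
  rw [← key]
  cases a with
  | one => simp [Digit.val, sum_range_succ' _ M]
  | two =>
    simp only [Digit.val, sum_range_succ' _ (M + 1), sum_range_succ' _ M]
    simp [fZero_snoc_two_one]
    exact sum_congr rfl fun i _ => by rw [show (i : ℚ) + 1 + 1 = i + 2 by ring]

theorem sum_fZero_of_le {x : YFWord} {M : ℕ} (hM : rank x < M) (φ : ℕ → ℚ) :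
    ∑ i ∈ range M, fZero x i * φ i = ∑ i ∈ range (rank x + 1), fZero x i * φ i := by
  symm
  apply sum_subset (by simpa using hM)
  intro i _ hi
  rw [fZero_eq_zero_of_lt (by simpa using hi), zero_mul]

/-- The divided difference of a constant. For `x = aw = vb`, dropping the top or the bottom node
gives the usual recurrence: `|x|` times the sum for `x` is the sum for `w` minus the sum for `v`. -/
theorem sum_fZero {x : YFWord} {M : ℕ} (hx : x ≠ []) (hM : rank x < M) :
    ∑ i ∈ range M, fZero x i = 0 := by
  obtain ⟨n, hn⟩ : ∃ n, x.length = n := ⟨_, rfl⟩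
  induction n using Nat.strong_induction_on generalizing x M with
  | _ n ih =>
    obtain ⟨a, w, rfl⟩ := List.exists_cons_of_ne_nil hx
    obtain ⟨v, b, e⟩ : ∃ v b, a :: w = v ++ [b] :=
      ⟨_, _, (List.dropLast_append_getLast hx).symm⟩
    have h1 : ∑ i ∈ range (M + b.val), fZero (a :: w) i * ((rank (a :: w) : ℚ) - i) =
        ∑ i ∈ range (M + b.val), fZero w i := by
      apply sum_congr rfl
      intro i _
      rw [fZero_cons]
    have h2 := sum_fZero_snoc b v M
    rw [← e] at h2
    have h3 : ∑ i ∈ range (M + b.val), fZero (a :: w) i = ∑ i ∈ range M, fZero (a :: w) i := by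
      have k1 := sum_fZero_of_le (M := M + b.val) (x := a :: w) (by omega) (fun _ => 1)
      have k2 := sum_fZero_of_le (M := M) (x := a :: w) (by omega) (fun _ => 1)
      simp only [mul_one] at k1 k2
      rw [k1, k2]
    have h4 : (rank (a :: w) : ℚ) * ∑ i ∈ range M, fZero (a :: w) i =
        ∑ i ∈ range (M + b.val), fZero w i - ∑ i ∈ range M, fZero v i := by
      rw [← h1, ← h3, mul_sum, sub_eq_add_neg, ← h2, ← sum_add_distrib]
      apply sum_congr rfl
      intro i _
      ring
    have hl : w.length = v.length := by
      have := congrArg List.length e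
      simpa using this
    have hr : rank (a :: w) = rank v + b.val := by rw [e, rank_snoc]
    have hr' := rank_cons a w
    have ha := val_pos a
    have h5 : ∑ i ∈ range (M + b.val), fZero w i - ∑ i ∈ range M, fZero v i = 0 := by
      by_cases hw : w = []
      · subst hw
        obtain rfl : v = [] := List.eq_nil_of_length_eq_zero (by simpa using hl.symm)
        have k1 := sum_fZero_of_le (M := M + b.val) (x := []) (by rw [rank_nil]; omega) (fun _ => 1)
        have k2 := sum_fZero_of_le (M := M) (x := []) (by rw [rank_nil]; omega) (fun _ => 1)
        simp only [mul_one] at k1 k2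
        rw [k1, k2, sub_self]
      · have hv : v ≠ [] := by
          rintro rfl
          exact hw (List.eq_nil_of_length_eq_zero (by simpa using hl))
        rw [List.length_cons] at hn
        rw [ih w.length (by omega) hw (by omega) rfl,
          ih v.length (by omega) hv (by omega) rfl, sub_self]
    rw [h5] at h4
    have h6 : (rank (a :: w) : ℚ) ≠ 0 := by exact_mod_cast (by omega : rank (a :: w) ≠ 0)
    exact (mul_eq_zero.mp h4).resolve_left h6

/-- Split a factor as `c j - i = (|x| - i) + (c j - |x|)`: the first part removes the top node, the
second lowers the degree. -/
theorem sum_fZero_mul_prod {x : YFWord} {M : ℕ} (hM : rank x < M) {ι : Type*} [DecidableEq ι]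
    (s : Finset ι) (c : ι → ℚ) (hs : s.card < x.length) :
    ∑ i ∈ range M, fZero x i * ∏ j ∈ s, (c j - (i : ℚ)) = 0 := by
  induction s using Finset.induction_on generalizing x with
  | empty =>
    simp only [prod_empty, mul_one]
    exact sum_fZero (by rintro rfl; simp at hs) hM
  | insert j s hj ih =>
    cases x with
    | nil => simp at hs
    | cons a w =>
      rw [card_insert_of_notMem hj, List.length_cons] at hs
      have hr := rank_cons a w
      have h1 := ih (x := a :: w) hM (by rw [List.length_cons]; omega)
      have h2 := ih (x := w) (by omega) (by omega)
      rw [← sum_fZero_cons a w (fun i => ∏ j ∈ s, (c j - (i : ℚ)))] at h2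
      have : ∀ i ∈ range M, fZero (a :: w) i * ∏ j ∈ insert j s, (c j - (i : ℚ)) =
          fZero (a :: w) i * (((rank (a :: w) : ℚ) - i) * ∏ j ∈ s, (c j - (i : ℚ))) +
            (c j - rank (a :: w)) * (fZero (a :: w) i * ∏ j ∈ s, (c j - (i : ℚ))) := by
        intro i _
        rw [prod_insert hj]
        ring
      rw [sum_congr rfl this, sum_add_distrib, ← mul_sum, h1, h2]
      simp

/-! ### The upper function -/

theorem numTwos_snoc_one (x : YFWord) : numTwos (x ++ [one]) = numTwos x := by
  simp [numTwos]

theorem numTwos_snoc_two (x : YFWord) : numTwos (x ++ [two]) = numTwos x + 1 := by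
  simp [numTwos]

theorem two_mul_numTwos_le (x : YFWord) : 2 * numTwos x ≤ rank x := by
  induction x using List.reverseRecOn with
  | nil => simp [numTwos]
  | append_singleton x a ih =>
    cases a
    · rw [numTwos_snoc_one, rank_snoc_one]; omega
    · rw [numTwos_snoc_two, rank_snoc_two]; omega

theorem g_snoc_one (x : YFWord) (j : ℕ) : g (x ++ [one]) (j + 1) = g x (j + 1) + 1 := by
  simp only [g, sum_range_succ' _ j]
  simp [beta, betaRev]
  ring

theorem g_snoc_two_one (x : YFWord) : g (x ++ [two]) 1 = 1 := by
  simp [g, beta, betaRev]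

theorem g_snoc_two (x : YFWord) (j : ℕ) : g (x ++ [two]) (j + 2) = g x (j + 1) + 2 := by
  rw [g, sum_range_succ' _ (j + 1), g]
  simp [beta, betaRev]
  ring

theorem prod_Icc_one (n : ℕ) (φ : ℕ → ℚ) : ∏ j ∈ Icc 1 n, φ j = ∏ j ∈ range n, φ (j + 1) := by
  induction n with
  | zero => simp
  | succ n ih => rw [prod_Icc_succ_top (by omega), ih, prod_range_succ]

/-- The polynomial `∏_j (g(y, j) - t)`. -/
def gPoly (y : YFWord) (t : ℚ) : ℚ := ∏ j ∈ range (numTwos y), ((g y (j + 1) : ℚ) - t)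

theorem gProd_eq_gPoly (y : YFWord) (i : ℕ) : gProd y i = gPoly y i := by
  rw [gProd, prod_Icc_one, gPoly]

theorem gPoly_snoc_one (y : YFWord) (t : ℚ) : gPoly (y ++ [one]) t = gPoly y (t - 1) := by
  simp only [gPoly, numTwos_snoc_one, g_snoc_one]
  apply prod_congr rfl
  intro j _
  push_cast
  ring

theorem gPoly_snoc_two (y : YFWord) (t : ℚ) :
    gPoly (y ++ [two]) t = (1 - t) * gPoly y (t - 2) := by
  simp only [gPoly, numTwos_snoc_two, prod_range_succ' _ (numTwos y), g_snoc_two]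
  simp only [zero_add, g_snoc_two_one, Int.cast_one]
  rw [mul_comm]
  congr 1
  apply prod_congr rfl
  intro j _
  push_cast
  ring

theorem gPoly_nil (t : ℚ) : gPoly [] t = 1 := by simp [gPoly, numTwos]

theorem sum_fZero_mul_gPoly {x y : YFWord} {M : ℕ} (hM : rank x < M) (h : numTwos y < x.length) :
    ∑ i ∈ range M, fZero x i * gPoly y i = 0 :=
  sum_fZero_mul_prod hM _ _ (by simpa using h)

/-- The polynomial `∏ (g(x, j) - t)`, over the `j` with `g(x, j) ≤ b`. -/
def gDenomPoly (x : YFWord) (t : ℚ) (b : ℤ) : ℚ :=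
  ∏ j ∈ range (numTwos x), if g x (j + 1) ≤ b then (g x (j + 1) : ℚ) - t else 1

theorem gDenom_eq (x : YFWord) (y b : ℕ) : gDenom x y b = gDenomPoly x y b := by
  rw [gDenom, prod_filter, prod_Icc_one, gDenomPoly]

theorem gDenomPoly_snoc_one (x : YFWord) (t : ℚ) (b : ℤ) :
    gDenomPoly (x ++ [one]) t b = gDenomPoly x (t - 1) (b - 1) := by
  simp only [gDenomPoly, numTwos_snoc_one, g_snoc_one]
  apply prod_congr rfl
  intro j _
  simp only [le_sub_iff_add_le]
  push_cast
  congr 1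
  ring

theorem gDenomPoly_snoc_two (x : YFWord) (t : ℚ) (b : ℤ) :
    gDenomPoly (x ++ [two]) t b =
      (if 1 ≤ b then 1 - t else 1) * gDenomPoly x (t - 2) (b - 2) := by
  simp only [gDenomPoly, numTwos_snoc_two, prod_range_succ' _ (numTwos x), g_snoc_two]
  simp only [zero_add, g_snoc_two_one, Int.cast_one]
  rw [mul_comm]
  congr 1
  apply prod_congr rfl
  intro j _
  simp only [le_sub_iff_add_le]
  push_cast
  congr 1
  ring

theorem gDenomPoly_of_nonpos (x : YFWord) (t : ℚ) {b : ℤ} (hb : b ≤ 0) : gDenomPoly x t b = 1 := by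
  induction x using List.reverseRecOn generalizing t b with
  | nil => simp [gDenomPoly, numTwos]
  | append_singleton x a ih =>
    cases a
    · rw [gDenomPoly_snoc_one, ih _ (by omega)]
    · rw [gDenomPoly_snoc_two, ih _ (by omega), if_neg (by omega), one_mul]

end YF
namespace YF

open Digit Finset

/-! ### The lower function -/

theorem f_snoc_one_succ (x : YFWord) (y z : ℕ) :
    f (x ++ [one]) (y + 1) (z + 1) = fZero (x ++ [one]) (y + 1) + f x y z := by
  rw [f_one_succ, f_zero]

theorem f_snoc_two_add_two (x : YFWord) (y z : ℕ) :
    f (x ++ [two]) (y + 2) (z + 1) =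
      (fZero (x ++ [one] ++ [one]) (y + 2) + (fZero (x ++ [one]) (y + 1) + f x y z)) /
        (1 - ((y : ℚ) + 2)) := by
  rw [f_two, if_neg (by omega), ← f_snoc_one_succ, ← f_snoc_one_succ]
  simp

theorem f_snoc_two_one (x : YFWord) (z : ℕ) : f (x ++ [two]) 1 (z + 1) = 0 := by
  rw [f_two, if_pos rfl]

theorem f_apply_zero (x : YFWord) {z : ℕ} (hz : z ≤ x.length) : f x 0 z = fZero x 0 := by
  cases z with
  | zero => exact f_zero x 0
  | succ z =>
    induction x using List.reverseRecOn with
    | nil => simp at hz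
    | append_singleton x a =>
      cases a
      · rw [f_one_zero, f_zero]
      · have := f_one_zero (x ++ [one]) (z + 1)
        rw [f_zero, List.append_assoc, List.singleton_append] at this
        rw [f_two, if_neg (by omega), this, fZero_snoc_two_zero]
        simp

theorem f_snoc_one_one (x : YFWord) {z : ℕ} (hz : z ≤ x.length) :
    f (x ++ [one]) 1 (z + 1) = 0 := by
  have := f_snoc_one_succ x 0 z
  rw [zero_add] at this
  rw [this, f_apply_zero x hz, fZero_snoc_one_one_add]

/-! ### The explicit form of the lower function. -/

theorem p_zero (x : YFWord) : p x 0 = 0 := by simp [p, rank_nil]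

theorem p_snoc (x : YFWord) (a : Digit) {z : ℕ} (hz : z ≤ x.length) :
    p (x ++ [a]) (z + 1) = p x z + a.val := by
  rw [p, p, ← rank_snoc, List.length_append, List.length_singleton, Nat.add_sub_add_right,
    List.drop_append_of_le_length (by omega)]

theorem p_snoc_one (x : YFWord) {z : ℕ} (hz : z ≤ x.length) :
    p (x ++ [one]) (z + 1) = p x z + 1 := p_snoc x one hz

theorem p_snoc_two (x : YFWord) {z : ℕ} (hz : z ≤ x.length) :
    p (x ++ [two]) (z + 1) = p x z + 2 := p_snoc x two hz

theorem p_length (x : YFWord) : p x x.length = rank x := by simp [p]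

theorem take_snoc (x : YFWord) (a : Digit) (z : ℕ) :
    (x ++ [a]).take ((x ++ [a]).length - (z + 1)) = x.take (x.length - z) := by
  rw [List.length_append, List.length_singleton, Nat.add_sub_add_right,
    List.take_append_of_le_length (by omega)]

theorem s_snoc_one_zero (x : YFWord) : s (x ++ [one]) 0 = x ++ [one] := by simp [s, sRev]

theorem s_snoc_one_succ (x : YFWord) (l : ℕ) : s (x ++ [one]) (l + 1) = s x l := by
  simp [s, sRev]

theorem s_snoc_two_zero (x : YFWord) : s (x ++ [two]) 0 = x ++ [one] ++ [one] := by
  simp [s, sRev]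

theorem s_snoc_two_one (x : YFWord) : s (x ++ [two]) 1 = x ++ [one] := by simp [s, sRev]

theorem s_snoc_two_add_two (x : YFWord) (l : ℕ) : s (x ++ [two]) (l + 2) = s x l := by
  simp [s, sRev]

/-- The summands in the explicit form of the lower function that do not depend on `z`. -/
def fSummand (x : YFWord) (y l : ℕ) : ℚ := fZero (s x l) (y - l) / gDenomPoly x y (l + 1)

/-- The last summand in the explicit form of the lower function. -/
def fLast (x : YFWord) (y z : ℕ) : ℚ :=
  fZero (x.take (x.length - z)) (y - p x z) / gDenomPoly x y (p x z)

theorem fSummand_snoc_one_zero (x : YFWord) (y : ℕ) :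
    fSummand (x ++ [one]) y 0 = fZero (x ++ [one]) y := by
  rw [fSummand, s_snoc_one_zero, gDenomPoly_snoc_one, gDenomPoly_of_nonpos _ _ (by simp)]
  simp

theorem fSummand_snoc_one_succ (x : YFWord) (y l : ℕ) :
    fSummand (x ++ [one]) (y + 1) (l + 1) = fSummand x y l := by
  rw [fSummand, s_snoc_one_succ, gDenomPoly_snoc_one, fSummand]
  simp

theorem fSummand_snoc_two_zero (x : YFWord) (y : ℕ) :
    fSummand (x ++ [two]) y 0 = fZero (x ++ [one] ++ [one]) y / (1 - y) := by
  rw [fSummand, s_snoc_two_zero, gDenomPoly_snoc_two, gDenomPoly_of_nonpos _ _ (by simp)]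
  simp

theorem fSummand_snoc_two_one (x : YFWord) (y : ℕ) :
    fSummand (x ++ [two]) (y + 2) 1 = fZero (x ++ [one]) (y + 1) / (1 - ((y : ℚ) + 2)) := by
  rw [fSummand, s_snoc_two_one, gDenomPoly_snoc_two, gDenomPoly_of_nonpos _ _ (by simp)]
  simp

theorem fSummand_snoc_two_add_two (x : YFWord) (y l : ℕ) :
    fSummand (x ++ [two]) (y + 2) (l + 2) = fSummand x y l / (1 - ((y : ℚ) + 2)) := by
  rw [fSummand, s_snoc_two_add_two, gDenomPoly_snoc_two, fSummand, if_pos (by omega),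
    div_div, mul_comm]
  congr 1
  · congr 1
    omega
  · push_cast
    congr 2 <;> ring

theorem fLast_snoc_one (x : YFWord) (y : ℕ) {z : ℕ} (hz : z ≤ x.length) :
    fLast (x ++ [one]) (y + 1) (z + 1) = fLast x y z := by
  rw [fLast, take_snoc, p_snoc x one hz, gDenomPoly_snoc_one, fLast]
  simp [Digit.val]

theorem fLast_snoc_two (x : YFWord) (y : ℕ) {z : ℕ} (hz : z ≤ x.length) :
    fLast (x ++ [two]) (y + 2) (z + 1) = fLast x y z / (1 - ((y : ℚ) + 2)) := by
  rw [fLast, take_snoc, p_snoc x two hz, gDenomPoly_snoc_two, fLast,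
    if_pos (by simp [Digit.val]; omega), div_div, mul_comm]
  simp [Digit.val]

/-- Unrolling the recursion from the right, each two passed contributes its factor `g - y` to the
denominator. If the last `z` digits reach `y`, the final contributions cancel by
`fZero_snoc_one_one_add`, so the sum stops at `l = y - 2`. In the ranges used, the factors have `g <
y` and are nonzero. -/
theorem f_eq_sum {x : YFWord} {y z : ℕ} (hz : z ≤ x.length) (hy : 1 ≤ y) :
    f x y z = if p x z < y then ∑ l ∈ range (p x z), fSummand x y l + fLast x y z
      else ∑ l ∈ range (y - 1), fSummand x y l := by
  induction x using List.reverseRecOn generalizing y z with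
  | nil =>
    obtain rfl : z = 0 := by simpa using hz
    rw [p_zero, if_pos (by omega), f_zero]
    simp [fLast, p_zero, gDenomPoly_of_nonpos]
  | append_singleton x a ih =>
    cases z with
    | zero =>
      rw [p_zero, if_pos (by omega), f_zero, fLast, Nat.sub_zero, List.take_length]
      simp [p_zero, gDenomPoly_of_nonpos]
    | succ z =>
      have hz' : z ≤ x.length := by simpa using hz
      obtain ⟨y, rfl⟩ : ∃ k, y = k + 1 := ⟨y - 1, by omega⟩
      cases a with
      | one =>
        rw [p_snoc_one x hz']
        rcases Nat.eq_zero_or_pos y with rfl | hy'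
        · rw [zero_add, if_neg (by omega), f_snoc_one_one x hz']
          simp
        · rw [f_snoc_one_succ, ih hz' hy', fLast_snoc_one x y hz', sum_range_succ' _ (p x z),
            Nat.add_sub_cancel, ← Nat.sub_add_cancel hy', sum_range_succ' _ (y - 1),
            Nat.sub_add_cancel hy']
          simp only [fSummand_snoc_one_zero, fSummand_snoc_one_succ]
          split_ifs
          · ring
          · omega
          · omega
          · ring
      | two =>
        rw [p_snoc_two x hz']
        rcases Nat.eq_zero_or_pos y with rfl | hy'
        · rw [zero_add, if_neg (by omega), f_snoc_two_one]
          simp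
        obtain ⟨y, rfl⟩ : ∃ k, y = k + 1 := ⟨y - 1, by omega⟩
        rw [show y + 1 + 1 = y + 2 from rfl, f_snoc_two_add_two, fLast_snoc_two x y hz']
        rcases Nat.eq_zero_or_pos y with rfl | hy''
        -- At argument `2` the inner two contributions cancel and only `l = 0` survives.
        · have := fZero_snoc_one_one_add x
          rw [if_neg (by omega), f_apply_zero x hz', zero_add, this]
          simp [fSummand_snoc_two_zero]
        · rw [ih hz' hy'', sum_range_succ' _ (p x z + 1), sum_range_succ' _ (p x z),
            show y + 2 - 1 = (y - 1) + 1 + 1 by omega,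
            sum_range_succ' _ (y - 1 + 1), sum_range_succ' _ (y - 1)]
          simp only [fSummand_snoc_two_zero, zero_add, fSummand_snoc_two_one,
            show ∀ k, k + 1 + 1 = k + 2 from fun _ => rfl, fSummand_snoc_two_add_two, ← sum_div]
          push_cast
          split_ifs
          · ring
          · omega
          · omega
          · ring

theorem f_eq_sum_fTerm {x : YFWord} {z : ℕ} (y : ℕ) (hz : z ≤ x.length) :
    f x y z = ∑ l ∈ range (fCount x y z), fTerm x y z l := by
  unfold fCount
  rcases Nat.eq_zero_or_pos y with rfl | hy
  · simp [fTerm, f_apply_zero x hz]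
  · have key : ∀ l < p x z, fTerm x y z l = fSummand x y l := by
      intro l hl
      rw [fTerm, if_neg (by omega), if_pos hl, gDenom_eq, fSummand]
      push_cast
      rfl
    rw [f_eq_sum hz hy, if_neg (show ¬y = 0 by omega)]
    split_ifs with h1
    · rw [sum_range_succ, sum_congr rfl fun l hl => key l (mem_range.mp hl)]
      rw [fTerm, if_neg (by omega), if_neg (lt_irrefl _), gDenom_eq, fLast]
    · symm
      apply sum_congr rfl
      intro l hl
      rw [mem_range] at hl
      exact key l (by omega)

/-- For `y ≤ p x z` the explicit form no longer involves `z`. -/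
theorem f_eq_of_le_p {x : YFWord} {y z z' : ℕ} (hz : z ≤ x.length) (hz' : z' ≤ x.length)
    (h : y ≤ p x z) (h' : y ≤ p x z') : f x y z = f x y z' := by
  rcases Nat.eq_zero_or_pos y with rfl | hy
  · rw [f_apply_zero x hz, f_apply_zero x hz']
  · rw [f_eq_sum hz hy, f_eq_sum hz' hy, if_neg (by omega), if_neg (by omega)]

/-- The recursion preserves the difference between digit sum and argument, so a new leftmost digit
gives every term the same factor. -/
theorem f_cons {w : YFWord} {i z : ℕ} (a : Digit) (hi : i ≤ rank w) (hz : z ≤ w.length) :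
    f (a :: w) i z = f w i z / ((rank (a :: w) : ℚ) - i) := by
  induction w using List.reverseRecOn generalizing i z with
  | nil =>
    obtain rfl : z = 0 := by simpa using hz
    rw [f_zero, f_zero, fZero_cons_eq_div hi]
  | append_singleton w b ih =>
    cases z with
    | zero => rw [f_zero, f_zero, fZero_cons_eq_div hi]
    | succ z =>
      have hz' : z ≤ w.length := by simpa using hz
      cases i with
      | zero =>
        rw [f_apply_zero _ hz, f_apply_zero _ (by simp; omega), fZero_cons_eq_div (by omega)]
      | succ i =>
        cases b with
        | one =>
          rw [rank_snoc_one] at hi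
          rw [← List.cons_append, f_snoc_one_succ, f_snoc_one_succ, ih (by omega) hz',
            List.cons_append, fZero_cons_eq_div (by rw [rank_snoc_one]; omega), rank_cons,
            rank_snoc_one, rank_cons]
          push_cast
          rw [add_div]
          congr 2
          ring
        | two =>
          rw [rank_snoc_two] at hi
          cases i with
          | zero => rw [← List.cons_append, f_snoc_two_one, f_snoc_two_one, zero_div]
          | succ i =>
            rw [← List.cons_append, show i + 1 + 1 = i + 2 from rfl, f_snoc_two_add_two,
              f_snoc_two_add_two, ih (by omega) hz']
            simp only [List.cons_append]
            rw [
              fZero_cons_eq_div (by rw [rank_snoc_one, rank_snoc_one]; omega),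
              fZero_cons_eq_div (by rw [rank_snoc_one]; omega), rank_cons, rank_cons, rank_cons,
              rank_cons, rank_snoc_one, rank_snoc_one, rank_snoc_two, div_right_comm, add_div,
              add_div]
            push_cast
            ring

/-- The argument lies inside the leading two, where there is no node. -/
theorem f_two_cons_rank_add_one (v : YFWord) {z : ℕ} (hz : z ≤ v.length + 1) :
    f (two :: v) (rank v + 1) z = 0 := by
  have h0 : ∀ v : YFWord, fZero (two :: v) (rank v + 1) = 0 := by
    intro v
    have := fZero_cons two v (rank v + 1)
    rw [fZero_eq_zero_of_lt (Nat.lt_succ_self _), rank_two_cons] at this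
    push_cast at this
    linarith
  induction v using List.reverseRecOn generalizing z with
  | nil =>
    cases z with
    | zero => rw [f_zero, h0]
    | succ z => exact f_snoc_two_one [] z
  | append_singleton v a ih =>
    cases z with
    | zero => rw [f_zero, h0]
    | succ z =>
      have hz' : z ≤ v.length + 1 := by simpa using hz
      cases a with
      | one =>
        have := h0 (v ++ [one])
        rw [rank_snoc_one] at this ⊢
        rw [← List.cons_append] at this ⊢
        rw [f_snoc_one_succ, this, ih hz', add_zero]
      | two =>
        have h1 := h0 (v ++ [one])
        have h2 := h0 (v ++ [one] ++ [one])
        rw [rank_snoc_one] at h1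
        rw [rank_snoc_one, rank_snoc_one] at h2
        rw [rank_snoc_two, ← List.cons_append, show rank v + 2 + 1 = rank v + 1 + 2 from rfl,
          f_snoc_two_add_two, ih hz']
        rw [List.cons_append, List.cons_append, h1, h2]
        simp

end YF
namespace YF

open Digit Finset

/-! ### The kernel of the down operator -/

/-- The exceptional word covered by `w a`, where `w` consists of twos. -/
def exceptional (w : YFWord) : Digit → YFWord
  | one => w
  | two => w ++ [one]

/-- A covering relation can affect the last digit only if all digits before it are twos; this costs
one extra word. -/
theorem sum_down_snoc (w : YFWord) (a : Digit) (φ : YFWord → ℚ) :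
    ∑ v ∈ down (w ++ [a]), φ v =
      ∑ v ∈ down w, φ (v ++ [a]) + if one ∈ w then 0 else φ (exceptional w a) := by
  induction w generalizing φ with
  | nil => cases a <;> simp [down, exceptional]
  | cons b w ih =>
    cases b with
    | one => simp [down]
    | two =>
      rw [List.cons_append, down_two, down_two, sum_up, sum_up, ih (fun v => φ (two :: v))]
      cases a <;> simp [exceptional, add_assoc]

theorem sum_up_snoc (w : YFWord) (a : Digit) (φ : YFWord → ℚ) :
    ∑ v ∈ up (w ++ [a]), φ v =
      ∑ v ∈ up w, φ (v ++ [a]) + if one ∈ w then 0 else φ (two :: exceptional w a) := by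
  rw [sum_up, sum_up, sum_down_snoc w a (fun v => φ (two :: v)), ← add_assoc]
  rfl

theorem two_cons_eq_snoc {w : YFWord} (hw : one ∉ w) : two :: w = w ++ [two] := by
  induction w with
  | nil => rfl
  | cons a w ih =>
    cases a with
    | one => simp at hw
    | two => rw [List.cons_append, ← ih (by simpa using hw)]

/-- The lower function `f(x, |x|, 0)`. -/
def fTop (x : YFWord) : ℚ := fZero x (rank x)

theorem fTop_nil : fTop [] = 1 := fZero_nil_zero

theorem fTop_snoc_one (x : YFWord) : fTop (x ++ [one]) = -fTop x / (rank x + 1) := by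
  rw [fTop, rank_snoc_one, fZero_snoc_one, fTop]

theorem fTop_snoc_two (x : YFWord) : fTop (x ++ [two]) = -fTop x / (rank x + 2) := by
  rw [fTop, rank_snoc_two, fZero_snoc_two, fTop]

theorem sum_up_fTop_snoc_one (w : YFWord) :
    ∑ v ∈ up w, fTop (v ++ [one]) = -(∑ v ∈ up w, fTop v) / (rank w + 2) := by
  rw [← sum_neg_distrib, sum_div]
  apply sum_congr rfl
  intro v hv
  rw [fTop_snoc_one, rank_of_mem_up hv]
  push_cast
  ring

theorem sum_up_fTop_snoc_two (w : YFWord) :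
    ∑ v ∈ up w, fTop (v ++ [two]) = -(∑ v ∈ up w, fTop v) / (rank w + 3) := by
  rw [← sum_neg_distrib, sum_div]
  apply sum_congr rfl
  intro v hv
  rw [fTop_snoc_two, rank_of_mem_up hv]
  push_cast
  ring

/-- For a word of twos a defect remains, to be repaired in `sum_up_topValue` by the common suffix
with `y`. -/
theorem sum_up_fTop (w : YFWord) : ∑ v ∈ up w, fTop v = if one ∈ w then 0 else -fTop w := by
  induction w using List.reverseRecOn with
  | nil =>
    have := fTop_snoc_one []
    rw [List.nil_append] at this
    simp [up, down, this, rank_nil]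
  | append_singleton w a ih =>
    have h2 : (rank w : ℚ) + 2 ≠ 0 := by positivity
    have h3 : (rank w : ℚ) + 3 ≠ 0 := by positivity
    rw [sum_up_snoc]
    cases a with
    | one =>
      rw [sum_up_fTop_snoc_one, ih, if_pos (show one ∈ w ++ [one] by simp)]
      split_ifs with hw
      · simp
      · rw [exceptional, two_cons_eq_snoc hw, fTop_snoc_two]
        field_simp
        ring
    | two =>
      rw [sum_up_fTop_snoc_two, ih]
      by_cases hw : one ∈ w
      · simp [hw]
      · rw [if_neg hw, if_neg hw, if_neg (by simpa using hw), exceptional, ← List.cons_append,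
          two_cons_eq_snoc hw, fTop_snoc_one, fTop_snoc_two, rank_snoc_two]
        have h3' : ((rank w + 2 : ℕ) : ℚ) + 1 = rank w + 3 := by push_cast; ring
        rw [h3']
        field_simp
        ring

/-- The factor `f(x, |x|, h(x, y))` of `F(x, y, |x|)`. -/
def topValue (x y : YFWord) : ℚ := f x (rank x) (h x y)

theorem topValue_eq_fTop {x y : YFWord} (hxy : h x y = 0) : topValue x y = fTop x := by
  rw [topValue, hxy, f_zero, fTop]

theorem topValue_nil_right (x : YFWord) : topValue x [] = fTop x :=
  topValue_eq_fTop (h_nil_right x)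

theorem topValue_snoc_of_ne (x y : YFWord) {a b : Digit} (hab : a ≠ b) :
    topValue (x ++ [a]) (y ++ [b]) = fTop (x ++ [a]) :=
  topValue_eq_fTop (by rw [h_snoc, if_neg hab])

theorem topValue_snoc_one (x y : YFWord) :
    topValue (x ++ [one]) (y ++ [one]) = fTop (x ++ [one]) + topValue x y := by
  rw [topValue, h_snoc, if_pos rfl, rank_snoc_one, f_snoc_one_succ, topValue, fTop, rank_snoc_one]

theorem topValue_snoc_two (x y : YFWord) :
    topValue (x ++ [two]) (y ++ [two]) = -(fTop (x ++ [two]) + topValue x y) / (rank x + 1) := by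
  have h1 : (rank x : ℚ) + 1 ≠ 0 := by positivity
  have h2 : (rank x : ℚ) + 2 ≠ 0 := by positivity
  have e1 : (((rank x + 1 : ℕ) : ℚ) + 1) = rank x + 2 := by push_cast; ring
  have e2 : (1 : ℚ) - (rank x + 2) = -(rank x + 1) := by ring
  rw [topValue, h_snoc, if_pos rfl, rank_snoc_two, f_snoc_two_add_two, fTop_snoc_two,
    fZero_snoc_one _ (rank x + 1), fZero_snoc_one, topValue, fTop, e1, e2]
  field_simp
  ring

/-- On words of twos the common suffix has no effect, which makes the exceptional terms computable.
-/
theorem topValue_of_one_notMem {w : YFWord} (y : YFWord) (hw : one ∉ w) :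
    topValue w y = fTop w := by
  induction w using List.reverseRecOn generalizing y with
  | nil => exact topValue_eq_fTop (h_nil_left y)
  | append_singleton w a ih =>
    rcases List.eq_nil_or_concat y with rfl | ⟨y, b, rfl⟩
    · exact topValue_nil_right _
    rw [List.concat_eq_append]
    cases a with
    | one => simp at hw
    | two =>
      cases b with
      | one => exact topValue_snoc_of_ne w y (by simp)
      | two =>
        have h1 : (rank w : ℚ) + 1 ≠ 0 := by positivity
        have h2 : (rank w : ℚ) + 2 ≠ 0 := by positivity
        rw [topValue_snoc_two, ih y (by simpa using hw), fTop_snoc_two]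
        field_simp
        ring

/-- The word `y` has a suffix with digit sum `i`. -/
def HasSuffixRank (y : YFWord) (i : ℕ) : Prop := ∃ u v : YFWord, y = u ++ v ∧ rank v = i

theorem hasSuffixRank_zero (y : YFWord) : HasSuffixRank y 0 := ⟨y, [], by simp, rfl⟩

theorem not_hasSuffixRank_nil (i : ℕ) : ¬ HasSuffixRank [] (i + 1) := by
  rintro ⟨u, v, e, hv⟩
  obtain ⟨rfl, rfl⟩ := List.append_eq_nil_iff.mp e.symm
  simp [rank_nil] at hv

theorem hasSuffixRank_snoc {y : YFWord} {a : Digit} {i : ℕ} (hi : i ≠ 0) :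
    HasSuffixRank (y ++ [a]) i ↔ ∃ k, i = k + a.val ∧ HasSuffixRank y k := by
  constructor
  · rintro ⟨u, v, e, rfl⟩
    rcases List.eq_nil_or_concat v with rfl | ⟨v, b, rfl⟩
    · simp [rank_nil] at hi
    · rw [List.concat_eq_append] at e ⊢
      rw [← List.append_assoc] at e
      obtain ⟨e1, e2⟩ := List.append_inj' e rfl
      obtain rfl : a = b := by simpa using e2
      exact ⟨rank v, rank_snoc v a, u, v, e1, rfl⟩
  · rintro ⟨k, rfl, u, v, rfl, rfl⟩
    exact ⟨u, v ++ [a], by simp, rank_snoc v a⟩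

theorem hasSuffixRank_snoc_one {y : YFWord} {i : ℕ} :
    HasSuffixRank (y ++ [one]) (i + 1) ↔ HasSuffixRank y i := by
  simp [hasSuffixRank_snoc, Digit.val]

theorem hasSuffixRank_snoc_two {y : YFWord} {i : ℕ} :
    HasSuffixRank (y ++ [two]) (i + 2) ↔ HasSuffixRank y i := by
  simp [hasSuffixRank_snoc, Digit.val]

theorem not_hasSuffixRank_snoc_two_one (y : YFWord) : ¬ HasSuffixRank (y ++ [two]) 1 := by
  rw [hasSuffixRank_snoc (by simp)]
  rintro ⟨k, hk, -⟩
  simp [Digit.val] at hk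

/-- The roots `g(y, j)` are the numbers `|v| + 1` with `y = u2v`, exactly those skipped by the
suffix sums. -/
theorem gPoly_eq_zero_or_hasSuffixRank {y : YFWord} {i : ℕ} (hi : i ≤ rank y) :
    gPoly y i = 0 ∨ HasSuffixRank y i := by
  induction y using List.reverseRecOn generalizing i with
  | nil =>
    obtain rfl : i = 0 := by simpa [rank_nil] using hi
    exact Or.inr (hasSuffixRank_zero _)
  | append_singleton y a ih =>
    rcases i with _ | i
    · exact Or.inr (hasSuffixRank_zero _)
    cases a with
    | one =>
      rw [rank_snoc_one] at hi
      rw [hasSuffixRank_snoc_one, gPoly_snoc_one]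
      simpa using ih (i := i) (by omega)
    | two =>
      rw [rank_snoc_two] at hi
      rcases i with _ | i
      · exact Or.inl (by simp [gPoly_snoc_two])
      · rw [hasSuffixRank_snoc_two, gPoly_snoc_two]
        rcases ih (i := i) (by omega) with e | e
        · left
          rw [show (((i + 1 + 1 : ℕ) : ℚ) - 2) = i by push_cast; ring, e, mul_zero]
        · exact Or.inr e

/-- Strip last digits: if they agree, the part inherited from the shorter words sums to zero by
induction, the suffix condition being inherited too; what is left is governed by `sum_up_fTop`. -/
theorem sum_up_topValue {w y : YFWord} (hy : HasSuffixRank y (rank w + 1)) :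
    ∑ v ∈ up w, topValue v y = 0 := by
  induction w using List.reverseRecOn generalizing y with
  | nil =>
    rcases List.eq_nil_or_concat y with rfl | ⟨y, b, rfl⟩
    · exact absurd hy (not_hasSuffixRank_nil _)
    rw [List.concat_eq_append] at hy ⊢
    cases b with
    | one =>
      have := topValue_snoc_one [] y
      have h2 := fTop_snoc_one []
      rw [List.nil_append] at this h2
      simp [up, down, this, h2, topValue_of_one_notMem, fTop_nil, rank_nil]
    | two => exact absurd hy (not_hasSuffixRank_snoc_two_one y)
  | append_singleton w a ih =>
    rcases List.eq_nil_or_concat y with rfl | ⟨y, b, rfl⟩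
    · exact absurd hy (not_hasSuffixRank_nil _)
    rw [List.concat_eq_append] at hy ⊢
    have hs := sum_up_fTop (w ++ [a])
    rw [sum_up_snoc] at hs ⊢
    cases a with
    | one =>
      rw [if_pos (show one ∈ w ++ [one] by simp)] at hs
      have he : (if one ∈ w then 0 else topValue (two :: exceptional w one) (y ++ [b])) =
          if one ∈ w then 0 else fTop (two :: exceptional w one) := by
        split_ifs with hw
        · rfl
        · exact topValue_of_one_notMem _ (by simpa [exceptional] using hw)
      rw [he]
      cases b with
      | one =>
        rw [rank_snoc_one, hasSuffixRank_snoc_one] at hy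
        simp only [topValue_snoc_one]
        rw [sum_add_distrib, ih hy, add_zero, hs]
      | two =>
        simp only [topValue_snoc_of_ne _ y (show one ≠ two by simp)]
        exact hs
    | two =>
      cases b with
      | one =>
        simp only [topValue_snoc_of_ne _ y (show two ≠ one by simp)]
        by_cases hw : one ∈ w
        · simpa [hw] using hs
        -- For `w` of twos the extra word is `w21`. It shares its last digit with `y`, and the
        -- resulting `fTop (w ++ [two])` cancels the defect.
        · rw [if_neg hw, if_neg (by simpa using hw), exceptional, ← List.cons_append,
            two_cons_eq_snoc hw] at hs
          rw [if_neg hw, exceptional, ← List.cons_append, two_cons_eq_snoc hw, topValue_snoc_one,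
            topValue_of_one_notMem _ (by simpa using hw), ← add_assoc, hs]
          ring
      | two =>
        rw [rank_snoc_two, show rank w + 2 + 1 = rank w + 1 + 2 from rfl,
          hasSuffixRank_snoc_two] at hy
        have h2 : (rank w : ℚ) + 2 ≠ 0 := by positivity
        have h3 : (rank w : ℚ) + 3 ≠ 0 := by positivity
        have e : ∑ v ∈ up w, topValue (v ++ [two]) (y ++ [two]) =
            -(∑ v ∈ up w, fTop (v ++ [two])) / (rank w + 2) := by
          have : ∀ v ∈ up w, topValue (v ++ [two]) (y ++ [two]) =
              -(fTop (v ++ [two]) + topValue v y) / (rank w + 2) := by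
            intro v hv
            rw [topValue_snoc_two, rank_of_mem_up hv]
            push_cast
            ring
          rw [sum_congr rfl this, ← sum_div, sum_neg_distrib, sum_add_distrib, ih hy, add_zero]
        rw [e]
        by_cases hw : one ∈ w
        · simp only [hw, if_true, List.mem_append, true_or, add_zero] at hs ⊢
          rw [hs]
          simp
        · rw [if_neg hw, sum_up_fTop_snoc_two, sum_up_fTop, if_neg hw, exceptional,
            ← List.cons_append, two_cons_eq_snoc hw,
            topValue_snoc_of_ne _ y (show one ≠ two by simp), fTop_snoc_one, fTop_snoc_two,
            rank_snoc_two]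
          have h3' : ((rank w + 2 : ℕ) : ℚ) + 1 = rank w + 3 := by push_cast; ring
          rw [h3']
          field_simp
          ring

/-! ### The identity as a sum of components -/

theorem F_eq (x y : YFWord) (i : ℕ) : F x y i = f x i (h x y) * gPoly y i := by
  rw [F, gProd_eq_gPoly]

theorem sum_F_of_h_eq_zero {x y : YFWord} (hxy : h x y = 0) (hl : numTwos y < x.length) :
    ∑ i ∈ range (rank x + 1), F x y i = 0 := by
  simp only [F_eq, hxy, f_zero]
  exact sum_fZero_mul_gPoly (Nat.lt_succ_self _) hl

theorem sum_F_snoc_one (x y : YFWord) :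
    ∑ i ∈ range (rank (x ++ [one]) + 1), F (x ++ [one]) (y ++ [one]) i =
      ∑ i ∈ range (rank (x ++ [one]) + 1), fZero (x ++ [one]) i * gPoly (y ++ [one]) i +
        ∑ i ∈ range (rank x + 1), F x y i := by
  rw [rank_snoc_one, sum_range_succ' _ (rank x + 1), sum_range_succ' _ (rank x + 1),
    add_right_comm, ← sum_add_distrib]
  congr 1
  · apply sum_congr rfl
    intro i _
    rw [F_eq, F_eq, h_snoc, if_pos rfl, f_snoc_one_succ, gPoly_snoc_one]
    push_cast
    rw [add_sub_cancel_right]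
    ring
  · rw [F_eq, f_apply_zero _ (h_le_length _ _)]

/-- The factor `1 - i` from the upper product cancels the denominator in `f(x2, i, ·)`, leaving what
`x11` and `y11` would give. -/
theorem sum_F_snoc_two (x y : YFWord) :
    ∑ i ∈ range (rank (x ++ [two]) + 1), F (x ++ [two]) (y ++ [two]) i =
      ∑ i ∈ range (rank x + 3), fZero (x ++ [one] ++ [one]) i * gPoly (y ++ [one] ++ [one]) i +
        ∑ i ∈ range (rank x + 2), fZero (x ++ [one]) i * gPoly (y ++ [one]) i +
          ∑ i ∈ range (rank x + 1), F x y i := by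
  rw [rank_snoc_two, show rank x + 2 + 1 = rank x + 1 + 1 + 1 from rfl,
    show rank x + 3 = rank x + 1 + 1 + 1 from rfl, show rank x + 2 = rank x + 1 + 1 from rfl]
  simp only [sum_range_succ' _ (rank x + 1 + 1), sum_range_succ' _ (rank x + 1)]
  have h0 : F (x ++ [two]) (y ++ [two]) 0 =
      fZero (x ++ [one] ++ [one]) 0 * gPoly (y ++ [one] ++ [one]) (0 : ℕ) := by
    rw [F_eq, f_apply_zero _ (h_le_length _ _), fZero_snoc_two_zero, gPoly_snoc_two,
      gPoly_snoc_one, gPoly_snoc_one]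
    norm_num
  have h1 : F (x ++ [two]) (y ++ [two]) (0 + 1) = 0 := by
    rw [F_eq, h_snoc, if_pos rfl, zero_add, f_snoc_two_one, zero_mul]
  -- These two terms have no partner on the left, where the summand at `1` is zero.
  have h2 : fZero (x ++ [one] ++ [one]) (0 + 1) * gPoly (y ++ [one] ++ [one]) ((0 + 1 : ℕ) : ℚ) +
      fZero (x ++ [one]) 0 * gPoly (y ++ [one]) ((0 : ℕ) : ℚ) = 0 := by
    rw [gPoly_snoc_one (y ++ [one]), show (((0 + 1 : ℕ) : ℚ) - 1) = ((0 : ℕ) : ℚ) by norm_num,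
      ← add_mul, zero_add, fZero_snoc_one_one_add, zero_mul]
  have h3 : ∑ i ∈ range (rank x + 1), F (x ++ [two]) (y ++ [two]) (i + 1 + 1) =
      ∑ i ∈ range (rank x + 1), fZero (x ++ [one] ++ [one]) (i + 1 + 1) *
          gPoly (y ++ [one] ++ [one]) ((i + 1 + 1 : ℕ) : ℚ) +
        ∑ i ∈ range (rank x + 1), fZero (x ++ [one]) (i + 1) *
          gPoly (y ++ [one]) ((i + 1 : ℕ) : ℚ) + ∑ i ∈ range (rank x + 1), F x y i := by
    rw [← sum_add_distrib, ← sum_add_distrib]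
    apply sum_congr rfl
    intro i _
    have e1 : ((i + 1 + 1 : ℕ) : ℚ) - 1 - 1 = i := by push_cast; ring
    have e2 : ((i + 1 + 1 : ℕ) : ℚ) - 2 = i := by push_cast; ring
    have e3 : ((i + 1 : ℕ) : ℚ) - 1 = i := by push_cast; ring
    have e4 : (1 : ℚ) - ((i + 1 + 1 : ℕ) : ℚ) = 1 - ((i : ℚ) + 2) := by push_cast; ring
    have e5 : 1 - ((i : ℚ) + 2) ≠ 0 := by
      have : (0 : ℚ) ≤ i := by positivity
      linarith
    rw [F_eq, F_eq, h_snoc, if_pos rfl, f_snoc_two_add_two, gPoly_snoc_two, gPoly_snoc_one,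
      gPoly_snoc_one, gPoly_snoc_one, e1, e2, e3, e4]
    field_simp
    ring
  rw [h0, h1, h3]
  linear_combination -h2

/-- Common last digits are removed one by one. All divided differences met on the way vanish by
degree, because `2 d(y) ≤ |y|` and `|x| ≤ 2 #x`. -/
theorem sum_F_eq_ite {x y : YFWord} (hxy : rank x = rank y) :
    ∑ i ∈ range (rank x + 1), F x y i = if x = y then 1 else 0 := by
  induction x using List.reverseRecOn generalizing y with
  | nil =>
    have := length_le_rank y
    rw [rank_nil] at hxy
    obtain rfl : y = [] := List.eq_nil_of_length_eq_zero (by omega)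
    simp [rank_nil, F_eq, h_nil_left, f_zero, fZero_nil_zero, gPoly_nil]
  | append_singleton x a ih =>
    rcases List.eq_nil_or_concat y with rfl | ⟨y, b, rfl⟩
    · have := length_le_rank (x ++ [a])
      rw [rank_nil] at hxy
      simp at this
      omega
    rw [List.concat_eq_append] at hxy ⊢
    have h1 := two_mul_numTwos_le y
    have h2 := rank_le_two_mul_length x
    rw [rank_snoc, rank_snoc] at hxy
    cases a <;> cases b <;> simp only [Digit.val] at hxy
    · rw [sum_F_snoc_one, ih (by omega), sum_fZero_mul_gPoly (Nat.lt_succ_self _)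
        (by rw [numTwos_snoc_one]; simp; omega), zero_add]
      simp
    · rw [sum_F_of_h_eq_zero (by simp [h_snoc]) (by rw [numTwos_snoc_two]; simp; omega)]
      simp
    · rw [sum_F_of_h_eq_zero (by simp [h_snoc]) (by rw [numTwos_snoc_one]; simp; omega)]
      simp
    · rw [sum_F_snoc_two, ih (by omega),
        sum_fZero_mul_gPoly (by rw [rank_snoc_one, rank_snoc_one]; omega)
          (by rw [numTwos_snoc_one, numTwos_snoc_one]; simp; omega),
        sum_fZero_mul_gPoly (by rw [rank_snoc_one]; omega)
          (by rw [numTwos_snoc_one]; simp; omega), zero_add, zero_add]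
      simp

/-! ### Components -/

/-- The function `x ↦ F(x, y, i)`, continued to the words of rank greater than `|y|`. -/
def component (y : YFWord) (i : ℕ) : YFWord → ℚ
  | [] => if i = 0 then F [] y 0 else 0
  | a :: w =>
    if rank (a :: w) < i then 0
    else if rank (a :: w) = i then F (a :: w) y i
    else component y i w / ((rank (a :: w) : ℚ) - i)

theorem component_of_lt {y x : YFWord} {i : ℕ} (h : rank x < i) : component y i x = 0 := by
  cases x with
  | nil => rw [component, if_neg (by omega)]
  | cons a w => rw [component, if_pos h]

theorem component_rank (y x : YFWord) : component y (rank x) x = F x y (rank x) := by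
  cases x with
  | nil => simp [component, rank_nil]
  | cons a w => rw [component, if_neg (lt_irrefl _), if_pos rfl]

theorem component_cons {a : Digit} {w : YFWord} (y : YFWord) {i : ℕ} (hi : i < rank (a :: w)) :
    component y i (a :: w) = component y i w / ((rank (a :: w) : ℚ) - i) := by
  rw [component, if_neg (by omega), if_neg (by omega)]

/-- The truncated difference is harmless: for `i ≥ |aw|` the word `w` has rank below `i`, and both
sides are zero. -/
theorem sub_mul_component_cons (a : Digit) (w y : YFWord) (i : ℕ) :
    ((rank (a :: w) - i : ℕ) : ℚ) * component y i (a :: w) = component y i w := by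
  rcases lt_or_ge i (rank (a :: w)) with hi | hi
  · have : (rank (a :: w) : ℚ) - i ≠ 0 := by
      rw [sub_ne_zero]
      exact_mod_cast hi.ne'
    rw [component_cons y hi, Nat.cast_sub hi.le]
    field_simp
  · have := val_pos a
    have hr := rank_cons a w
    rw [Nat.sub_eq_zero_of_le hi, component_of_lt (x := w) (by omega)]
    simp

/-- Above rank `i`, the words `1w` and `2v` have equal rank, so their values share one denominator
and the hypothesis adds up the numerators. For `i = |w| + 1` this is the kernel condition. -/
theorem sum_up_component_of_sum_down {w y : YFWord} {i : ℕ} (hi : i ≤ rank y)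
    (hd : ∑ v ∈ down w, component y i v = ((rank w - i : ℕ) : ℚ) * component y i w) :
    ∑ v ∈ up w, component y i v = component y i w := by
  rcases lt_trichotomy i (rank w + 1) with h | h | h
  · have h0 : (rank w : ℚ) + 1 - i ≠ 0 := by
      rw [sub_ne_zero]
      exact_mod_cast h.ne'
    have e : ∀ v ∈ down w, component y i (two :: v) =
        component y i v / ((rank w : ℚ) + 1 - i) := by
      intro v hv
      have hr := rank_of_mem_down hv
      rw [component_cons y (by rw [rank_two_cons]; omega), rank_two_cons, hr]
      push_cast
      congr 1
      ring
    rw [sum_up, sum_congr rfl e, ← sum_div, hd, component_cons y (by rw [rank_one_cons]; omega),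
      rank_one_cons, Nat.cast_sub (by omega)]
    push_cast
    field_simp
    ring
  · rw [component_of_lt (by omega)]
    subst h
    have e : ∀ v ∈ up w, component y (rank w + 1) v =
        topValue v y * gPoly y ((rank w + 1 : ℕ) : ℚ) := by
      intro v hv
      rw [← rank_of_mem_up hv, component_rank, F_eq, topValue]
    rw [sum_congr rfl e, ← sum_mul]
    rcases gPoly_eq_zero_or_hasSuffixRank hi with h0 | h0
    · rw [h0, mul_zero]
    · rw [sum_up_topValue h0, zero_mul]
  · rw [component_of_lt (by omega)]
    apply sum_eq_zero
    intro v hv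
    rw [component_of_lt (by rw [rank_of_mem_up hv]; exact h)]

theorem sum_down_component {y : YFWord} {i : ℕ} (hi : i ≤ rank y) (x : YFWord) :
    ∑ v ∈ down x, component y i v = ((rank x - i : ℕ) : ℚ) * component y i x := by
  induction x with
  | nil => simp [down, rank_nil]
  | cons a w ih =>
    rw [sub_mul_component_cons]
    cases a with
    | one => simp [down]
    | two =>
      rw [down_two]
      exact sum_up_component_of_sum_down hi ih

theorem sum_up_component {y : YFWord} {i : ℕ} (hi : i ≤ rank y) (x : YFWord) :
    ∑ v ∈ up x, component y i v = component y i x :=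
  sum_up_component_of_sum_down hi (sum_down_component hi x)

theorem F_cons {a : Digit} {w : YFWord} (y : YFWord) {i : ℕ} (hi : i ≤ rank w) :
    F (a :: w) y i = F w y i / ((rank (a :: w) : ℚ) - i) := by
  have key : f (a :: w) i (h (a :: w) y) = f (a :: w) i (h w y) := by
    rcases h_cons a w y with e | ⟨e1, e2⟩
    · rw [e]
    · have hp : p (a :: w) w.length = rank w := by simp [p]
      have hp' : p (a :: w) (w.length + 1) = rank (a :: w) := p_length (a :: w)
      have hr := rank_cons a w
      rw [e1, e2]
      exact f_eq_of_le_p (by simp) (by simp) (by omega) (by omega)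
  rw [F_eq, F_eq, key, f_cons a hi (h_le_length _ _)]
  ring

theorem component_eq_F {x : YFWord} (y : YFWord) {i : ℕ} (hi : i ≤ rank x) :
    component y i x = F x y i := by
  induction x with
  | nil =>
    obtain rfl : i = 0 := by simpa [rank_nil] using hi
    exact component_rank y []
  | cons a w ih =>
    rcases hi.eq_or_lt with rfl | hi'
    · exact component_rank y _
    rw [component_cons y hi']
    rcases le_or_gt i (rank w) with hw | hw
    · rw [ih hw, F_cons y hw]
    -- Now `i = |w| + 1` lies inside a leading two, and both sides vanish.
    · cases a with
      | one => rw [rank_one_cons] at hi'; omega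
      | two =>
        rw [rank_two_cons] at hi'
        obtain rfl : i = rank w + 1 := by omega
        rw [component_of_lt hw, F_eq, f_two_cons_rank_add_one w (by simpa using h_le_length (two :: w) y)]
        simp

/-! ### Assembling the count of walks and of summands. -/

theorem ncard_walks_eq (x y : YFWord) (n : ℕ) :
    ((walks y n x).ncard : ℚ) =
      ∑ i ∈ range (rank y + 1), hermiteCoeff n (rank x - i) (rank y - i) * component y i x := by
  induction n generalizing x with
  | zero =>
    rw [ncard_walks_zero]
    by_cases hr : rank x = rank y
    · simp only [hr, hermiteCoeff_zero, if_true, one_mul]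
      have := sum_F_eq_ite hr
      rw [hr] at this
      rw [Nat.cast_ite, Nat.cast_one, Nat.cast_zero, ← this]
      apply sum_congr rfl
      intro i hi
      rw [mem_range] at hi
      rw [component_eq_F y (by omega)]
    · rw [if_neg (by rintro rfl; exact hr rfl)]
      symm
      rw [Nat.cast_zero]
      apply sum_eq_zero
      intro i hi
      rw [mem_range] at hi
      rcases lt_or_ge (rank x) i with hx | hx
      · rw [component_of_lt hx, mul_zero]
      · rw [hermiteCoeff_zero, if_neg (by omega), zero_mul]
  | succ n ih =>
    rw [ncard_walks_succ]
    push_cast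
    simp only [ih]
    rw [sum_comm, sum_comm (s := up x), ← sum_add_distrib]
    apply sum_congr rfl
    intro i hi
    have hi' : i ≤ rank y := by rw [mem_range] at hi; omega
    have e1 : ∑ v ∈ down x, hermiteCoeff n (rank v - i) (rank y - i) * component y i v =
        hermiteCoeff n (rank x - i - 1) (rank y - i) *
          (((rank x - i : ℕ) : ℚ) * component y i x) := by
      rw [← sum_down_component hi', mul_sum]
      apply sum_congr rfl
      intro v hv
      rw [rank_of_mem_down hv]
      congr 2
      omega
    have e2 : ∑ v ∈ up x, hermiteCoeff n (rank v - i) (rank y - i) * component y i v =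
        hermiteCoeff n (rank x + 1 - i) (rank y - i) * component y i x := by
      rw [← sum_up_component hi' x, mul_sum]
      apply sum_congr rfl
      intro v hv
      rw [rank_of_mem_up hv]
    rw [e1, e2]
    -- For `i > |x|` the component is zero, so the truncated `|x| - i` does not matter.
    rcases lt_or_ge (rank x) i with hx | hx
    · simp [component_of_lt hx]
    · rw [hermiteCoeff_succ, show rank x + 1 - i = rank x - i + 1 by omega]
      ring

theorem numPaths_eq_sum {x y : YFWord} (S : ℕ) (hxy : rank x ≤ rank y) :
    (numPaths x y S : ℚ) = ∑ i ∈ range (rank x + 1),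
      (∑ k ∈ range (m (rank x - i) S + 1), coeff (rank x - i) (rank y - i) S k) * F x y i := by
  have hn : rank y + 2 * S - rank x + rank x = rank y + 2 * S := by omega
  rw [numPaths_eq hn, ncard_walks_eq]
  rw [← sum_subset (s₁ := range (rank x + 1)) (by simp [hxy])]
  · apply sum_congr rfl
    intro i hi
    rw [mem_range] at hi
    rw [component_eq_F y (by omega),
      sum_coeff_eq_hermiteCoeff (n := rank y + 2 * S - rank x) (by omega)]
  · intro i _ hi
    rw [component_of_lt (by simpa using hi), mul_zero]

theorem numPaths_eq_sum_explicitTerm {x y : YFWord} (S : ℕ) (hxy : rank x ≤ rank y) :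
    (numPaths x y S : ℚ) = ∑ t ∈ explicitIndex x y S, explicitTerm x y S t := by
  rw [numPaths_eq_sum S hxy, explicitIndex, sum_sigma]
  apply sum_congr rfl
  intro i _
  rw [sum_product, F, f_eq_sum_fTerm i (h_le_length x y), sum_mul]
  apply sum_congr rfl
  intro k _
  rw [sum_mul, mul_sum]
  apply sum_congr rfl
  intro l _
  rw [explicitTerm, mul_assoc]

theorem card_explicitIndex_le (x y : YFWord) (S : ℕ) (hx : 1 ≤ rank x) :
    (explicitIndex x y S).card ≤ 4 * rank x ^ 3 := by
  rw [explicitIndex, card_sigma]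
  -- There are at most `2|x|` values of `k` and `|x|` of `l`; with `|x| + 1 ≤ 2|x|` values of `i`
  -- this yields the constant `4`.
  have key : ∀ i ∈ range (rank x + 1),
      (range (m (rank x - i) S + 1) ×ˢ range (fCount x i (h x y))).card ≤
        2 * rank x * rank x := by
    intro i hi
    rw [mem_range] at hi
    rw [card_product, card_range, card_range]
    apply Nat.mul_le_mul
    · have : m (rank x - i) S ≤ (rank x - i) / 2 := min_le_left _ _
      omega
    · unfold fCount
      split_ifs <;> omega
  calc _ ≤ (range (rank x + 1)).card * (2 * rank x * rank x) := by
        simpa using sum_le_card_nsmul _ _ _ key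
    _ ≤ 2 * rank x * (2 * rank x * rank x) := by
        rw [card_range]
        exact Nat.mul_le_mul_right _ (by omega)
    _ = 4 * rank x ^ 3 := by ring

end YF

theorem mainTheorem3 :
    (∀ (x y : YFWord) (S : ℕ), YF.rank x ≤ YF.rank y →
      (YF.sPaths x y S).Finite ∧
      (YF.numPaths x y S : ℚ) =
        ∑ i ∈ Finset.range (YF.rank x + 1),
          (∑ k ∈ Finset.range (YF.m (YF.rank x - i) S + 1),
            YF.coeff (YF.rank x - i) (YF.rank y - i) S k) * YF.F x y i) ∧
    (∀ (x : YFWord) (i z : ℕ), i ≤ YF.rank x → z ≤ x.length →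
      YF.f x i z = ∑ l ∈ Finset.range (YF.fCount x i z), YF.fTerm x i z l) ∧
    (∀ (x y : YFWord) (S : ℕ), YF.rank x ≤ YF.rank y →
      (YF.numPaths x y S : ℚ) = ∑ t ∈ YF.explicitIndex x y S, YF.explicitTerm x y S t) ∧
    (∃ C : ℕ, ∀ (x y : YFWord) (S : ℕ), YF.rank x ≤ YF.rank y → 1 ≤ YF.rank x →
      (YF.explicitIndex x y S).card ≤ C * YF.rank x ^ 3) :=
  ⟨fun _ _ S hxy => ⟨YF.finite_sPaths S hxy, YF.numPaths_eq_sum S hxy⟩,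
    fun _ i _ _ hz => YF.f_eq_sum_fTerm i hz,
    fun _ _ S hxy => YF.numPaths_eq_sum_explicitTerm S hxy,
    4, fun x y S _ hx => YF.card_explicitIndex_le x y S hx⟩
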